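/- Let $\ell>0$, let $\Lambda_\ell=(\mathbb R/\ell\mathbb Z)^3$ be the three-dimensional torus of side length $\ell$, let $\mathcal F=\bigoplus_{n\ge 0}\bigotimes^n_{\rm sym}L^2(\mathbb R^3)$ be the bosonic Fock space, and let $\mathscr H_\ell=L^2(\Lambda_\ell)\otimes\mathcal F$. Elements of $\mathscr H_\ell$ are written $\Psi=(\Psi^{(n)})_{n\ge 0}$ with $\Psi^{(n)}(x,y_1,\dots,y_n)$ square integrable on $\Lambda_\ell\times\mathbb R^{3n}$ and symmetric in $y_1,\dots,y_n$. For $\alpha>0$ let $$h_\ell=(-\mathrm i\nabla_x-P_f)^2+N+\sqrt\alpha\,\big(a(v)+a^*(v)\big),\qquad v(y)=\frac{1}{|y|^{2}},$$ where $P_f=\mathrm d\Gamma(-\mathrm i\nabla)$, $N=\mathrm d\Gamma(1)$ and $(a(v)\Psi)^{(n)}(x,y_1,\dots,y_n)=\sqrt{n+1}\int_{\mathbb R^3}v(y)\Psi^{(n+1)}(x,y_1,\dots,y_n,y)\,dy$. Since $v\notin L^2(\mathbb R^3)$, this is understood as the operator associated with the sesquilinear form $$q(\Phi,\Psi)=\langle(-\mathrm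 i\nabla_x-P_f)\Phi,(-\mathrm i\nabla_x-P_f)\Psi\rangle+\langle N^{1/2}\Phi,N^{1/2}\Psi\rangle+\sqrt\alpha\sum_{n\ge0}\Big(\big\langle\Phi^{(n)},(a(v)\Psi)^{(n)}\big\rangle+\big\langle (a(v)\Phi)^{(n)},\Psi^{(n)}\big\rangle\Big)$$ on the form domain $\mathcal Q$ of $(-\mathrm i\nabla_x-P_f)^2+N$; that is, $\Psi\in D(h_\ell)$ and $h_\ell\Psi=\eta$ if and only if $\Psi\in\mathcal Q$ and $q(\Phi,\Psi)=\langle\Phi,\eta\rangle$ for all $\Phi\in\mathcal Q$. Let $$\mathcal C=\big\{\Psi\in\mathscr H_\ell \,:\, (-1)^n\Psi^{(n)}(x,y_1,\dots,y_n)\ge 0\ \text{almost everywhere, for all } n\ge 0\big\}.$$ Then, for all $\alpha>0$ and $\ell>0$, the infimum $\inf\sigma(h_\ell)$ of the spectrum of $h_\ell$ is finite, and for every real $\lambda>-\inf\sigma(h_\ell)$ the resolvent $(h_\ell+\lambda)^{-1}$ is positivity improving with respect to $\mathcal C$, that is, $\langle(h_\ell+\lambda)^{-1}u,w\rangle>0$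 for all $u,w\in\mathcal C\setminus\{0\}$. -/

import Mathlib

open MeasureTheory
open scoped ComplexOrder ENNReal InnerProductSpace

noncomputable section

namespace Polaron

/-- Physical space `ℝ³` with the Euclidean norm and Lebesgue measure. -/
abbrev R3 : Type := EuclideanSpace ℝ (Fin 3)

/-- The cube `[0, ℓ]³` with periodic boundary conditions, i.e. the torus `(ℝ / ℓℤ)³`. -/
abbrev Torus (ℓ : ℝ) : Type := Fin 3 → AddCircle ℓ

/-- Configurations `(x, y₁, …, yₙ)` of one electron on the torus and `n` phonons in `ℝ³`. -/
abbrev Conf (ℓ : ℝ) (n : ℕ) : Type := Torus ℓ × (Fin n → R3)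

section

variable (ℓ : ℝ) [Fact (0 < ℓ)] (n : ℕ)

/-- Square integrable (not necessarily symmetric) functions of `(x, y₁, …, yₙ)`. -/
abbrev L2 : Type := Lp ℂ 2 (volume : Measure (Conf ℓ n))

/-- Relabelling of the phonons. -/
def permMap (σ : Equiv.Perm (Fin n)) (z : Conf ℓ n) : Conf ℓ n := (z.1, fun j => z.2 (σ j))

theorem permMap_preserving (σ : Equiv.Perm (Fin n)) :
    MeasurePreserving (permMap ℓ n σ) volume volume := by
  have h := volume_measurePreserving_piCongrLeft (fun _ : Fin n => R3) σ.symm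
  have h2 : MeasurePreserving (fun (y : Fin n → R3) (j : Fin n) => y (σ j)) volume volume := by
    convert h using 1
    funext y j
    have := Equiv.piCongrLeft_apply_apply (P := fun _ : Fin n => R3) σ.symm y (σ j)
    simpa [MeasurableEquiv.coe_piCongrLeft] using this.symm
  exact (MeasurePreserving.id volume).prod h2

/-- The displacement `(t eᵢ, -t eᵢ, …, -t eᵢ)`. -/
def displacement (i : Fin 3) (t : ℝ) : Conf ℓ n :=
  (Pi.single i (t : AddCircle ℓ), fun _ => -EuclideanSpace.single i t)

/-- The map `(x, y₁, …, yₙ) ↦ (x + t eᵢ, y₁ - t eᵢ, …, yₙ - t eᵢ)`. -/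
def shiftMap (i : Fin 3) (t : ℝ) (z : Conf ℓ n) : Conf ℓ n := z + displacement ℓ n i t

theorem shiftMap_preserving (i : Fin 3) (t : ℝ) :
    MeasurePreserving (shiftMap ℓ n i t) volume volume :=
  (volume_preserving_pi fun k =>
      measurePreserving_add_right (volume : Measure (AddCircle ℓ))
        ((displacement ℓ n i t).1 k)).prod
    (volume_preserving_pi fun j =>
      measurePreserving_add_right (volume : Measure R3) ((displacement ℓ n i t).2 j))

/-- `L²(Λ_ℓ) ⊗ F⁽ⁿ⁾`: the square integrable functions of `(x, y₁, …, yₙ)` that are symmetric in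
the phonon variables. -/
def nPhonon : Submodule ℂ (L2 ℓ n) :=
  ⨅ σ : Equiv.Perm (Fin n),
    LinearMap.eqLocus
      (Lp.compMeasurePreservingₗ ℂ (permMap ℓ n σ) (permMap_preserving ℓ n σ)) LinearMap.id

/-- The Hilbert space `L²(Λ_ℓ) ⊗ F`, with `F` the bosonic Fock space over `L²(ℝ³)`, as the Hilbert
sum of its `n`-phonon sectors. -/
abbrev Hilb : Type := lp (fun n : ℕ => nPhonon ℓ n) 2

variable {ℓ}

/-- The `n`-phonon component `Ψ⁽ⁿ⁾(x, y₁, …, yₙ)`. -/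
def comp (Ψ : Hilb ℓ) (n : ℕ) : L2 ℓ n := (Ψ n : nPhonon ℓ n)

variable {n}

/-- The unitary group `t ↦ f(x + t eᵢ, y₁ - t eᵢ, …, yₙ - t eᵢ)` generated by the `i`-th component
of `-i∇ₓ - P_f`, where `P_f = dΓ(-i∇)`. -/
def shift (i : Fin 3) (f : L2 ℓ n) (t : ℝ) : L2 ℓ n :=
  Lp.compMeasurePreserving (shiftMap ℓ n i t) (shiftMap_preserving ℓ n i t) f

/-- `f` lies in the domain of the `i`-th component of `∇ₓ - ∑ⱼ ∇_{yⱼ} = i(-i∇ₓ - P_f)`. -/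
def InGradDomain (i : Fin 3) (f : L2 ℓ n) : Prop := DifferentiableAt ℝ (shift i f) 0

/-- The `i`-th component of `(∇ₓ - ∑ⱼ ∇_{yⱼ}) f`, as a derivative in `L²` along translations. -/
def grad (i : Fin 3) (f : L2 ℓ n) : L2 ℓ n := deriv (shift i f) 0

/-- The form domain of the non-interacting operator `(-i∇ₓ - P_f)² + N`. -/
def FormDomain (ℓ : ℝ) [Fact (0 < ℓ)] : Set (Hilb ℓ) :=
  {Ψ | (∀ n i, InGradDomain i (comp Ψ n)) ∧
    Summable fun n : ℕ => (∑ i, ‖grad i (comp Ψ n)‖ ^ 2) + n * ‖comp Ψ n‖ ^ 2}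

/-- The form factor `v(y) = |y|⁻²`. -/
def v (y : R3) : ℝ := 1 / ‖y‖ ^ 2

/-- The annihilation operator:
`(a(v)Ψ)⁽ⁿ⁾(x, y₁, …, yₙ) = √(n+1) ∫ v(y) Ψ⁽ⁿ⁺¹⁾(x, y₁, …, yₙ, y) dy`. -/
def annihilate (Ψ : Hilb ℓ) (n : ℕ) (z : Conf ℓ n) : ℂ :=
  (Real.sqrt (n + 1) : ℂ) *
    ∫ y : R3, (v y : ℂ) * comp Ψ (n + 1) (z.1, Fin.snoc (α := fun _ => R3) z.2 y)

/-- The sesquilinear form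
`⟨Φ, ((-i∇ₓ - P_f)² + N) Ψ⟩ + √α (⟨Φ, a(v)Ψ⟩ + ⟨a(v)Φ, Ψ⟩)` of `h_ℓ`, sector by sector. -/
def form (α : ℝ) (Φ Ψ : Hilb ℓ) : ℂ :=
  ∑' n : ℕ,
    ((∑ i, ⟪grad i (comp Φ n), grad i (comp Ψ n)⟫_ℂ) + n * ⟪comp Φ n, comp Ψ n⟫_ℂ
      + (Real.sqrt α : ℂ) *
        ((∫ z, starRingEnd ℂ (comp Φ n z) * annihilate Ψ n z)
          + ∫ z, starRingEnd ℂ (annihilate Φ n z) * comp Ψ n z))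

/-- The graph of `h_ℓ = (-i∇ₓ - P_f)² + N + √α φ(v)`, the operator associated with `form α`:
`Ψ` is in its domain and `h_ℓ Ψ = η` iff `Ψ` is in the form domain and `form α Φ Ψ = ⟨Φ, η⟩` for
all `Φ` in the form domain. -/
def hGraph (α ℓ : ℝ) [Fact (0 < ℓ)] : Set (Hilb ℓ × Hilb ℓ) :=
  {p | p.1 ∈ FormDomain ℓ ∧ ∀ Φ ∈ FormDomain ℓ, form α Φ p.1 = ⟪Φ, p.2⟫_ℂ}

/-- The cone of all `Ψ` with `(-1)ⁿ Ψ⁽ⁿ⁾(x, y₁, …, yₙ) ≥ 0` (real and non-negative) almost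
everywhere, for every `n`. -/
def cone (ℓ : ℝ) [Fact (0 < ℓ)] : Set (Hilb ℓ) :=
  {Ψ | ∀ n : ℕ, ∀ᵐ z, (0 : ℂ) ≤ (-1) ^ n * comp Ψ n z}

end

section

variable {H : Type*} [NormedAddCommGroup H] [InnerProductSpace ℂ H]

/-- `R` is the bounded, everywhere defined inverse of `A - w`, where `A` is given by its graph `G`:
`R f = Ψ` iff `Ψ ∈ D(A)` and `AΨ = wΨ + f`. -/
def IsResolvent (G : Set (H × H)) (w : ℂ) (R : H →L[ℂ] H) : Prop :=
  ∀ f Ψ : H, R f = Ψ ↔ (Ψ, w • Ψ + f) ∈ G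

/-- The spectrum of the operator with graph `G`. -/
def spec (G : Set (H × H)) : Set ℂ := {w | ¬ ∃ R : H →L[ℂ] H, IsResolvent G w R}

/-- `K` is positivity improving with respect to `C`: `⟨Ku, w⟩ > 0` for nonzero `u`, `w` in `C`. -/
def PositivityImproving (C : Set H) (K : H →L[ℂ] H) : Prop :=
  ∀ u ∈ C, ∀ w ∈ C, u ≠ 0 → w ≠ 0 → (0 : ℂ) < ⟪K u, w⟫_ℂ

end

end Polaron

end

/-!
The operator is bounded below because Hardy's inequality, applied along the simultaneous
translations generated by `-i∇ₓ - P_f`, bounds `a(v)` by the square root of the kinetic energy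
times that of the number of phonons.

All interaction terms of the form are negative on the cone, and replacing every component by
`(-1)ⁿ` times its absolute value lowers the energy of translations as well as the interaction.
Comparing the minimizers of the variational problem of the resolvent, one sees that the resolvent
preserves the cone. For strict positivity, let `Ψ` be the resolvent applied to a nonzero element of
the cone. If an element of the cone is orthogonal to `Ψ`, so is its image under the resolvent of
the free operator with larger spectral parameter, since all terms of the resolvent identity have
the same sign, and then the interaction term vanishes too. Iterating the free resolvent, the mean
ergodic theorem produces the vacuum, so that `Ψ⁽⁰⁾ ≠ 0` almost everywhere; the vanishing of the
interaction term carries this over from `Ψ⁽ⁿ⁾` to `Ψ⁽ⁿ⁺¹⁾`. This settles large spectral parameters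
`lam`. The others are reached by the Neumann series around a large `lam₀`, all of whose terms
preserve the cone, and the infimum of the spectrum is `‖R‖⁻¹ - lam₀` for the resolvent `R` at
`-lam₀`.
-/

noncomputable section

namespace Polaron

open Filter Topology

/-- A strongly continuous one-parameter group of linear isometries of a real normed space. -/
structure IsometryGroup (E : Type*) [NormedAddCommGroup E] [NormedSpace ℝ E] where
  /-- The isometry at a given time. -/
  isometry : ℝ → E →ₗᵢ[ℝ] E
  zero_apply : ∀ x, isometry 0 x = x
  add_apply : ∀ s t x, isometry (s + t) x = isometry s (isometry t x)
  continuous_orbit : ∀ x, Continuous fun t => isometry t x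

namespace IsometryGroup

section NormedSpace

variable {E F : Type*} [NormedAddCommGroup E] [NormedSpace ℝ E] [NormedAddCommGroup F]
  [NormedSpace ℝ F]

instance : CoeFun (IsometryGroup E) fun _ => ℝ → E →ₗᵢ[ℝ] E := ⟨isometry⟩

/-- `f` lies in the domain of the infinitesimal generator of `U`, which maps it to `g`. -/
def HasGenerator (U : IsometryGroup E) (f g : E) : Prop := HasDerivAt (fun t => U t f) g 0

variable {U : IsometryGroup E} {f g : E}

theorem HasGenerator.hasDerivAt (h : U.HasGenerator f g) (t : ℝ) :
    HasDerivAt (fun s => U s f) (U t g) t := by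
  have hshifted : HasDerivAt (fun s => U (s - t) f) g t := by
    simpa using HasDerivAt.comp_sub_const (f := fun s => U s f) (f' := g) t t
      (by simpa [HasGenerator] using h)
  have hmapped := (U t).toContinuousLinearMap.hasFDerivAt.comp_hasDerivAt t hshifted
  refine hmapped.congr_of_eventuallyEq (Eventually.of_forall fun s => ?_)
  simp [← U.add_apply]

theorem HasGenerator.norm_sub_le (h : U.HasGenerator f g) (t : ℝ) : ‖U t f - f‖ ≤ ‖g‖ * |t| := by
  have := convex_univ.norm_image_sub_le_of_norm_hasDerivWithin_le (f := fun t => U t f)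
    (f' := fun t => U t g) (C := ‖g‖) (fun s _ => (h.hasDerivAt s).hasDerivWithinAt)
    (fun s _ => by simp) (Set.mem_univ (0 : ℝ)) (Set.mem_univ t)
  simpa [U.zero_apply] using this

theorem HasGenerator.map {V : IsometryGroup F} (T : E →L[ℝ] F) (hT : ∀ t x, T (U t x) = V t (T x))
    (h : U.HasGenerator f g) : V.HasGenerator (T f) (T g) := by
  simpa [HasGenerator, Function.comp_def, hT] using T.hasFDerivAt.comp_hasDerivAt 0 h

theorem HasGenerator.add {f' g' : E} (h : U.HasGenerator f g) (h' : U.HasGenerator f' g') :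
    U.HasGenerator (f + f') (g + g') := by
  simpa [HasGenerator, Pi.add_def] using HasDerivAt.add h h'

theorem HasGenerator.zero : U.HasGenerator 0 0 := by
  simpa [HasGenerator] using hasDerivAt_const (0 : ℝ) (0 : E)

end NormedSpace

section Integral

variable {E : Type*} [NormedAddCommGroup E] [NormedSpace ℝ E] (U : IsometryGroup E)

theorem intervalIntegrable_orbit (x : E) (a b : ℝ) :
    IntervalIntegrable (fun s => U s x) volume a b :=
  (U.continuous_orbit x).intervalIntegrable a b

/-- The operator `x ↦ ∫ s in 0..t, U s x`. -/
def integral (t : ℝ) : E →L[ℝ] E :=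
  LinearMap.mkContinuous
    { toFun := fun x => ∫ s in (0 : ℝ)..t, U s x
      map_add' := fun x y => by
        simp only [map_add]
        exact intervalIntegral.integral_add (U.intervalIntegrable_orbit x _ _)
          (U.intervalIntegrable_orbit y _ _)
      map_smul' := fun c x => by
        simp only [map_smul, RingHom.id_apply]
        exact intervalIntegral.integral_smul c _ } |t| fun x => by
    simpa [mul_comm] using
      intervalIntegral.norm_integral_le_of_norm_le_const (a := 0) (b := t) (f := fun s => U s x)
        (C := ‖x‖) fun s _ => by simp

theorem integral_apply (t : ℝ) (x : E) : U.integral t x = ∫ s in (0 : ℝ)..t, U s x := rfl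

variable [CompleteSpace E]

theorem hasDerivAt_integral (x : E) (t : ℝ) : HasDerivAt (fun r => U.integral r x) (U t x) t :=
  intervalIntegral.integral_hasDerivAt_right (U.intervalIntegrable_orbit x _ _)
    ((U.continuous_orbit x).stronglyMeasurableAtFilter _ _) (U.continuous_orbit x).continuousAt

theorem hasGenerator_iff_integral {f g : E} :
    U.HasGenerator f g ↔ ∀ t, U t f - f = U.integral t g := by
  constructor
  · intro h t
    rw [integral_apply, intervalIntegral.integral_eq_sub_of_hasDerivAt (fun s _ => h.hasDerivAt s)
      (U.intervalIntegrable_orbit g _ _), U.zero_apply]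
  · intro h
    have h1 := (U.hasDerivAt_integral g 0).add_const f
    rw [U.zero_apply] at h1
    refine h1.congr_of_eventuallyEq (Eventually.of_forall fun t => ?_)
    simp [← h t]

theorem isClosed_hasGenerator : IsClosed {p : E × E | U.HasGenerator p.1 p.2} := by
  simp only [hasGenerator_iff_integral, Set.ofPred_forall]
  exact isClosed_iInter fun t => isClosed_eq
    (((U t).continuous.comp continuous_fst).sub continuous_fst)
    ((U.integral t).continuous.comp continuous_snd)

theorem map_integral (t δ : ℝ) (f : E) :
    U t (U.integral δ f) = U.integral (t + δ) f - U.integral t f := by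
  simp only [integral_apply]
  rw [intervalIntegral.integral_interval_sub_left (U.intervalIntegrable_orbit f _ _)
    (U.intervalIntegrable_orbit f _ _)]
  have h := (U t).toContinuousLinearMap.intervalIntegral_comp_comm
    (U.intervalIntegrable_orbit f 0 δ)
  simp only [LinearIsometry.coe_toContinuousLinearMap, ← U.add_apply] at h
  rw [← h, intervalIntegral.integral_comp_add_left (fun s => U s f), add_zero]

theorem hasGenerator_integral (δ : ℝ) (f : E) : U.HasGenerator (U.integral δ f) (U δ f - f) := by
  have h1 : HasDerivAt (fun t => U.integral (t + δ) f) (U δ f) 0 :=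
    HasDerivAt.comp_add_const 0 δ (by simpa using U.hasDerivAt_integral f δ)
  have h2 := h1.sub (U.hasDerivAt_integral f 0)
  rw [U.zero_apply] at h2
  exact h2.congr_of_eventuallyEq (Eventually.of_forall fun t => U.map_integral t δ f)

theorem tendsto_average (f : E) :
    Tendsto (fun δ : ℝ => δ⁻¹ • U.integral δ f) (𝓝[>] 0) (𝓝 f) := by
  have h := U.hasDerivAt_integral f 0
  rw [U.zero_apply] at h
  simpa [slope_fun_def, integral_apply] using
    (hasDerivAt_iff_tendsto_slope.1 h).mono_left (nhdsGT_le_nhdsNE 0)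

end Integral

end IsometryGroup

theorem exists_weak_limit {𝕜 H ι : Type*} [RCLike 𝕜] [NormedAddCommGroup H]
    [InnerProductSpace 𝕜 H] [CompleteSpace H] (𝒰 : Ultrafilter ι) {x : ι → H} {C : ℝ}
    (hx : ∀ᶠ i in 𝒰, ‖x i‖ ≤ C) :
    ∃ y : H, ‖y‖ ≤ C ∧ ∀ z : H, Tendsto (fun i => inner 𝕜 (x i) z) 𝒰 (𝓝 (inner 𝕜 y z)) := by
  let F : ι → WeakDual 𝕜 H := fun i => StrongDual.toWeakDual (InnerProductSpace.toDual 𝕜 H (x i))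
  have hball := WeakDual.isCompact_closedBall (𝕜 := 𝕜) (E := H) 0 C
  obtain ⟨w, hwC, hw⟩ := hball.ultrafilter_le_nhds (𝒰.map F) (by
    rw [le_principal_iff]
    change ∀ᶠ i in (𝒰 : Filter ι), _
    filter_upwards [hx] with i hi
    simpa [F] using hi)
  refine ⟨(InnerProductSpace.toDual 𝕜 H).symm (WeakDual.toStrongDual w), by simpa using hwC,
    fun z => ?_⟩
  simpa [F, Function.comp_def] using
    ((WeakDual.eval_continuous z).tendsto w).comp (show Tendsto F 𝒰 (𝓝 w) from hw)

namespace IsometryGroup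

variable {H : Type*} [NormedAddCommGroup H] [InnerProductSpace ℝ H] [CompleteSpace H]
  {U : IsometryGroup H}

/-- The averages `δ⁻¹ ∫ s in 0..δ, U s f` converge to `f`, and their generators, the difference
quotients `δ⁻¹ (U δ f - f)`, are bounded, hence have a weak limit point. -/
theorem exists_hasGenerator_of_lipschitz {f : H} {C : ℝ}
    (hf : ∀ᶠ t in 𝓝[>] (0 : ℝ), ‖U t f - f‖ ≤ C * t) :
    ∃ g : H, U.HasGenerator f g ∧ ‖g‖ ≤ C := by
  let 𝒰 : Ultrafilter ℝ := Ultrafilter.of (𝓝[>] (0 : ℝ))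
  have h𝒰 : (𝒰 : Filter ℝ) ≤ 𝓝[>] (0 : ℝ) := Ultrafilter.of_le _
  have hbound : ∀ᶠ δ : ℝ in 𝒰, ‖δ⁻¹ • (U δ f - f)‖ ≤ C := by
    filter_upwards [h𝒰 hf, h𝒰 self_mem_nhdsWithin] with t ht (ht0 : 0 < t)
    rw [norm_smul, norm_inv, Real.norm_of_nonneg ht0.le, inv_mul_le_iff₀ ht0, mul_comm]
    exact ht
  obtain ⟨g, hgC, hg⟩ := exists_weak_limit (𝕜 := ℝ) 𝒰 hbound
  refine ⟨g, U.hasGenerator_iff_integral.2 fun t => ext_inner_right ℝ fun z => ?_, hgC⟩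
  have hleft : Tendsto (fun δ : ℝ => inner ℝ (U t (δ⁻¹ • U.integral δ f) - δ⁻¹ • U.integral δ f) z)
      𝒰 (𝓝 (inner ℝ (U t f - f) z)) :=
    have h := (U.tendsto_average f).mono_left h𝒰
    ((((U t).continuous.tendsto f).comp h).sub h).inner tendsto_const_nhds
  have hright : Tendsto (fun δ : ℝ => inner ℝ (U.integral t (δ⁻¹ • (U δ f - f))) z)
      𝒰 (𝓝 (inner ℝ (U.integral t g) z)) := by
    simpa only [← ContinuousLinearMap.adjoint_inner_right] using hg _
  refine tendsto_nhds_unique hleft (hright.congr fun δ => ?_)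
  rw [map_smul, map_smul, ← U.hasGenerator_iff_integral.1 (U.hasGenerator_integral δ f) t, smul_sub]

theorem HasGenerator.exists_of_contraction {f g : H} (h : U.HasGenerator f g) {Φ : H → H}
    (hΦ : LipschitzWith 1 Φ) (hcomm : ∀ t x, Φ (U t x) = U t (Φ x)) :
    ∃ g', U.HasGenerator (Φ f) g' ∧ ‖g'‖ ≤ ‖g‖ := by
  refine exists_hasGenerator_of_lipschitz ?_
  filter_upwards [self_mem_nhdsWithin] with t (ht : 0 < t)
  have hΦt := hΦ.norm_sub_le (U t f) f
  rw [NNReal.coe_one, one_mul] at hΦt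
  rw [← hcomm]
  exact hΦt.trans ((h.norm_sub_le t).trans_eq (by rw [abs_of_pos ht]))

end IsometryGroup

section AbsoluteValue

variable {X Y : Type*} [MeasurableSpace X] [MeasurableSpace Y] {μ : Measure X} {ν : Measure Y}
  {p : ℝ≥0∞}

theorem lipschitzWith_ofReal_norm : LipschitzWith 1 fun w : ℂ => ((‖w‖ : ℝ) : ℂ) :=
  LipschitzWith.of_dist_le_mul fun a b => by
    rw [Complex.isometry_ofReal.dist_eq, NNReal.coe_one, one_mul, dist_eq_norm a]
    exact dist_norm_norm_le a b

/-- The pointwise absolute value of a complex `Lᵖ` function, again as a complex function. -/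
def absLp (f : Lp ℂ p μ) : Lp ℂ p μ := lipschitzWith_ofReal_norm.compLp (by simp) f

theorem coeFn_absLp (f : Lp ℂ p μ) : absLp f =ᵐ[μ] fun z => ((‖f z‖ : ℝ) : ℂ) :=
  LipschitzWith.coeFn_compLp _ _ f

theorem norm_absLp (f : Lp ℂ p μ) : ‖absLp f‖ = ‖f‖ := by
  refine le_antisymm (Lp.norm_le_norm_of_ae_le ?_) (Lp.norm_le_norm_of_ae_le ?_) <;>
  · filter_upwards [coeFn_absLp f] with z hz
    simp [hz]

theorem lipschitzWith_absLp [Fact (1 ≤ p)] :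
    LipschitzWith 1 (absLp : Lp ℂ p μ → Lp ℂ p μ) :=
  LipschitzWith.of_dist_le_mul fun f g => by
    simpa only [dist_eq_norm, absLp] using
      lipschitzWith_ofReal_norm.norm_compLp_sub_le (by simp) f g

theorem absLp_compMeasurePreserving (f : Lp ℂ p ν) {τ : X → Y} (hτ : MeasurePreserving τ μ ν) :
    absLp (Lp.compMeasurePreserving τ hτ f) = Lp.compMeasurePreserving τ hτ (absLp f) := by
  refine Lp.ext ?_
  filter_upwards [coeFn_absLp (Lp.compMeasurePreserving τ hτ f),
    Lp.coeFn_compMeasurePreserving f hτ, Lp.coeFn_compMeasurePreserving (absLp f) hτ,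
    hτ.quasiMeasurePreserving.ae_eq_comp (coeFn_absLp f)] with z habs hf habsf hcomp
  rw [habs, hf, habsf, hcomp]
  rfl

end AbsoluteValue

section Shift

variable {ℓ : ℝ} {n : ℕ}

theorem displacement_zero (i : Fin 3) : displacement ℓ n i 0 = 0 := by
  ext j <;> simp [displacement]

theorem displacement_add (i : Fin 3) (s t : ℝ) :
    displacement ℓ n i (s + t) = displacement ℓ n i s + displacement ℓ n i t := by
  refine Prod.ext (by simp [displacement, Pi.single_add]) (funext fun j => ?_)
  simp only [displacement, PiLp.single_add, Prod.snd_add, Pi.add_apply, neg_add]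

theorem continuous_displacement (i : Fin 3) : Continuous (displacement ℓ n i) :=
  ((continuous_single i).comp (AddCircle.continuous_mk' ℓ)).prodMk
    (continuous_pi fun _ => ((PiLp.continuous_toLp 2 _).comp
      (continuous_single (A := fun _ : Fin 3 => ℝ) i)).neg)

variable [Fact (0 < ℓ)]

instance : Measure.Regular (volume : Measure (Conf ℓ n)) :=
  Measure.Regular.of_sigmaCompactSpace_of_isLocallyFiniteMeasure _

/-- The translations `shift i`, as a strongly continuous isometry group. -/
def shiftGroup (i : Fin 3) : IsometryGroup (L2 ℓ n) where
  isometry t := Lp.compMeasurePreservingₗᵢ ℝ (shiftMap ℓ n i t) (shiftMap_preserving ℓ n i t)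
  zero_apply f := by
    refine Lp.ext ?_
    filter_upwards [Lp.coeFn_compMeasurePreserving f (shiftMap_preserving ℓ n i 0)] with z hz
    exact hz.trans (by simp [shiftMap, displacement_zero])
  add_apply s t f := by
    refine Lp.ext ?_
    filter_upwards [Lp.coeFn_compMeasurePreserving f (shiftMap_preserving ℓ n i (s + t)),
      Lp.coeFn_compMeasurePreserving (shift i f t) (shiftMap_preserving ℓ n i s),
      (shiftMap_preserving ℓ n i s).quasiMeasurePreserving.ae_eq_comp
        (Lp.coeFn_compMeasurePreserving f (shiftMap_preserving ℓ n i t))] with z hst hs ht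
    refine hst.trans (Eq.trans ?_ (hs.trans ht).symm)
    simp [shiftMap, displacement_add, add_assoc]
  continuous_orbit f :=
    let g : C(ℝ × Conf ℓ n, Conf ℓ n) := ⟨fun p => p.2 + displacement ℓ n i p.1,
      continuous_snd.add ((continuous_displacement i).comp continuous_fst)⟩
    Continuous.compMeasurePreservingLp (μ := (volume : Measure (Conf ℓ n)))
      (ν := (volume : Measure (Conf ℓ n))) (g := g.curry) continuous_const g.curry.continuous
      (fun t => shiftMap_preserving ℓ n i t) (by norm_num)

variable {i : Fin 3} {f g : L2 ℓ n}

theorem coeFn_shiftGroup (t : ℝ) (f : L2 ℓ n) :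
    shiftGroup i t f =ᵐ[volume] fun z => f (shiftMap ℓ n i t z) :=
  Lp.coeFn_compMeasurePreserving f (shiftMap_preserving ℓ n i t)

theorem InGradDomain.hasGenerator (h : InGradDomain i f) :
    (shiftGroup i).HasGenerator f (grad i f) :=
  DifferentiableAt.hasDerivAt h

theorem hasGenerator_smul (c : ℂ) (h : (shiftGroup i).HasGenerator f g) :
    (shiftGroup i).HasGenerator (c • f) (c • g) :=
  IsometryGroup.HasGenerator.map (U := shiftGroup i)
    ((c • ContinuousLinearMap.id ℂ (L2 ℓ n)).restrictScalars ℝ)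
    (fun t x => (map_smul (Lp.compMeasurePreservingₗᵢ ℂ (shiftMap ℓ n i t)
      (shiftMap_preserving ℓ n i t)) c x).symm) h

theorem exists_hasGenerator_absLp (h : (shiftGroup i).HasGenerator f g) :
    ∃ g', (shiftGroup i).HasGenerator (absLp f) g' ∧ ‖g'‖ ≤ ‖g‖ :=
  h.exists_of_contraction lipschitzWith_absLp fun t x =>
    absLp_compMeasurePreserving x (shiftMap_preserving ℓ n i t)

end Shift

section Symmetric

variable {ℓ : ℝ} [Fact (0 < ℓ)] {n : ℕ} {f : L2 ℓ n}

theorem mem_nPhonon : f ∈ nPhonon ℓ n ↔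
    ∀ σ, Lp.compMeasurePreserving (permMap ℓ n σ) (permMap_preserving ℓ n σ) f = f := by
  simp only [nPhonon, Submodule.mem_iInf, LinearMap.mem_eqLocus]
  rfl

theorem mem_nPhonon_iff_ae : f ∈ nPhonon ℓ n ↔
    ∀ σ, ∀ᵐ z, f (permMap ℓ n σ z) = f z := by
  refine mem_nPhonon.trans (forall_congr' fun σ => ?_)
  have h := Lp.coeFn_compMeasurePreserving f (permMap_preserving ℓ n σ)
  exact Lp.ext_iff.trans ⟨fun h' => h.symm.trans h', fun h' => h.trans h'⟩

theorem isClosed_nPhonon : IsClosed (nPhonon ℓ n : Set (L2 ℓ n)) := by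
  simp only [nPhonon, Submodule.coe_iInf]
  exact isClosed_iInter fun σ => isClosed_eq (Lp.compMeasurePreservingₗᵢ ℂ (permMap ℓ n σ)
    (permMap_preserving ℓ n σ)).continuous continuous_id

instance : CompleteSpace (nPhonon ℓ n) := isClosed_nPhonon.completeSpace_coe

theorem absLp_mem_nPhonon (hf : f ∈ nPhonon ℓ n) : absLp f ∈ nPhonon ℓ n := by
  rw [mem_nPhonon] at hf ⊢
  exact fun σ => by rw [← absLp_compMeasurePreserving, hf σ]

end Symmetric

section Multiplication

variable {X : Type*} [MeasurableSpace X] {μ : Measure X}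

theorem integrable_norm_sq (f : Lp ℂ 2 μ) : Integrable (fun z => ‖f z‖ ^ 2) μ :=
  (memLp_two_iff_integrable_sq_norm (Lp.aestronglyMeasurable f)).1 (Lp.memLp f)

theorem L2_norm_sq_eq_integral (f : Lp ℂ 2 μ) : ‖f‖ ^ 2 = ∫ z, ‖f z‖ ^ 2 ∂μ := by
  rw [← real_inner_self_eq_norm_sq, L2.inner_def]
  simp

variable [TopologicalSpace X] [OpensMeasurableSpace X]

theorem integrable_mul_norm_sq (w : BoundedContinuousFunction X ℝ) (f : Lp ℂ 2 μ) :
    Integrable (fun z => w z * ‖f z‖ ^ 2) μ :=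
  (integrable_norm_sq f).bdd_mul (c := ‖w‖) w.continuous.aestronglyMeasurable
    (Eventually.of_forall w.norm_coe_le_norm)

theorem memLp_top_ofReal (w : BoundedContinuousFunction X ℝ) :
    MemLp (fun z => (w z : ℂ)) ∞ μ :=
  memLp_top_of_bound (Complex.continuous_ofReal.comp w.continuous).aestronglyMeasurable ‖w‖
    (Eventually.of_forall fun z => by simpa using w.norm_coe_le_norm z)

/-- Multiplication by a bounded continuous real function, as an operator on `L²`. -/
def mulL2 (μ : Measure X) (w : BoundedContinuousFunction X ℝ) : Lp ℂ 2 μ →L[ℂ] Lp ℂ 2 μ :=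
  (ContinuousLinearMap.mul ℂ ℂ).holderL μ ∞ 2 2 (memLp_top_ofReal w).toLp

variable (w : BoundedContinuousFunction X ℝ) (f g : Lp ℂ 2 μ)

theorem coeFn_mulL2 : mulL2 μ w f =ᵐ[μ] fun z => (w z : ℂ) * f z := by
  filter_upwards [(ContinuousLinearMap.mul ℂ ℂ).coeFn_holder (r := 2)
    (memLp_top_ofReal w).toLp f, (memLp_top_ofReal w).coeFn_toLp] with z hz hw
  exact hz.trans (by simp [hw])

theorem inner_mulL2_right : ⟪f, mulL2 μ w g⟫_ℝ = ⟪mulL2 μ w f, g⟫_ℝ := by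
  simp only [L2.inner_def]
  refine integral_congr_ae ?_
  filter_upwards [coeFn_mulL2 w f, coeFn_mulL2 w g] with z hf hg
  simp only [hf, hg, ← Complex.real_smul, inner_smul_left, inner_smul_right, conj_trivial]

theorem inner_mulL2_self : ⟪f, mulL2 μ w f⟫_ℝ = ∫ z, w z * ‖f z‖ ^ 2 ∂μ := by
  rw [L2.inner_def]
  refine integral_congr_ae ?_
  filter_upwards [coeFn_mulL2 w f] with z hf
  simp only [hf, ← Complex.real_smul, inner_smul_right, real_inner_self_eq_norm_sq]

theorem norm_sq_mulL2 : ‖mulL2 μ w f‖ ^ 2 = ∫ z, (w ^ 2) z * ‖f z‖ ^ 2 ∂μ := by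
  rw [L2_norm_sq_eq_integral]
  refine integral_congr_ae ?_
  filter_upwards [coeFn_mulL2 w f] with z hf
  simp [hf, mul_pow]

end Multiplication

section Virial

variable {ℓ : ℝ} {n : ℕ}

theorem shiftMap_neg_shiftMap (i : Fin 3) (t : ℝ) (z : Conf ℓ n) :
    shiftMap ℓ n i (-t) (shiftMap ℓ n i t z) = z := by
  simp [shiftMap, add_assoc, ← displacement_add, displacement_zero]

variable [Fact (0 < ℓ)]

theorem integral_mul_norm_sq_shiftGroup (i : Fin 3) (t : ℝ)
    (w : BoundedContinuousFunction (Conf ℓ n) ℝ) (f : L2 ℓ n) :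
    ∫ z, w z * ‖shiftGroup i t f z‖ ^ 2 = ∫ z, w (shiftMap ℓ n i (-t) z) * ‖f z‖ ^ 2 := by
  rw [← (shiftMap_preserving ℓ n i t).integral_comp
    (Homeomorph.addRight (displacement ℓ n i t)).measurableEmbedding
    fun z => w (shiftMap ℓ n i (-t) z) * ‖f z‖ ^ 2]
  refine integral_congr_ae ?_
  filter_upwards [coeFn_shiftGroup (i := i) t f] with z hz
  rw [hz, shiftMap_neg_shiftMap]

theorem hasDerivAt_integral_mul_norm_sq {i : Fin 3} {w w' : BoundedContinuousFunction (Conf ℓ n) ℝ}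
    (hw : ∀ z t, HasDerivAt (fun t => w (shiftMap ℓ n i t z)) (w' (shiftMap ℓ n i t z)) t)
    (f : L2 ℓ n) :
    HasDerivAt (fun t => ∫ z, w (shiftMap ℓ n i t z) * ‖f z‖ ^ 2) (∫ z, w' z * ‖f z‖ ^ 2) 0 := by
  let τ (t : ℝ) : C(Conf ℓ n, Conf ℓ n) :=
    ⟨shiftMap ℓ n i t, (Homeomorph.addRight (displacement ℓ n i t)).continuous⟩
  have h := (hasDerivAt_integral_of_dominated_loc_of_deriv_le (𝕜 := ℝ) (μ := volume)
    (F := fun t z => w (shiftMap ℓ n i t z) * ‖f z‖ ^ 2)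
    (F' := fun t z => w' (shiftMap ℓ n i t z) * ‖f z‖ ^ 2)
    (bound := fun z => ‖w'‖ * ‖f z‖ ^ 2) (x₀ := 0) univ_mem
    (Eventually.of_forall fun t => (integrable_mul_norm_sq (w.compContinuous (τ t)) f).1)
    (integrable_mul_norm_sq (w.compContinuous (τ 0)) f)
    (integrable_mul_norm_sq (w'.compContinuous (τ 0)) f).1
    (Eventually.of_forall fun z t _ => by
      rw [norm_mul, norm_pow, norm_norm]
      gcongr
      exact w'.norm_coe_le_norm _)
    ((integrable_norm_sq f).const_mul _)
    (Eventually.of_forall fun z t _ => (hw z t).mul_const _)).2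
  simpa [shiftMap, displacement_zero] using h

/-- The derivative of `∫ w |U t f|²` at `0`, computed once on the weight and once on the
function. -/
theorem abs_integral_deriv_mul_norm_sq_le {i : Fin 3}
    {w w' : BoundedContinuousFunction (Conf ℓ n) ℝ}
    (hw : ∀ z t, HasDerivAt (fun t => w (shiftMap ℓ n i t z)) (w' (shiftMap ℓ n i t z)) t)
    {f g : L2 ℓ n} (hf : (shiftGroup i).HasGenerator f g) :
    |∫ z, w' z * ‖f z‖ ^ 2| ≤ 2 * (‖mulL2 volume w f‖ * ‖g‖) := by
  have honWeight : HasDerivAt (fun t => ⟪shiftGroup i t f, mulL2 volume w (shiftGroup i t f)⟫_ℝ)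
      (-∫ z, w' z * ‖f z‖ ^ 2) 0 := by
    simp only [inner_mulL2_self, integral_mul_norm_sq_shiftGroup]
    have h := hasDerivAt_integral_mul_norm_sq hw f
    rw [← neg_zero] at h
    exact (h.scomp 0 (hasDerivAt_neg 0)).congr_deriv (by simp)
  have honFunction := HasDerivAt.inner ℝ hf
    (((mulL2 volume w).restrictScalars ℝ).hasFDerivAt.comp_hasDerivAt 0 hf)
  have hderiv : -∫ z, w' z * ‖f z‖ ^ 2 = 2 * ⟪mulL2 volume w f, g⟫_ℝ := by
    rw [honWeight.unique honFunction, Function.comp_apply, (shiftGroup i).zero_apply, two_mul,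
      real_inner_comm _ g]
    exact congrArg (· + _) (inner_mulL2_right w f g)
  rw [← abs_neg, hderiv, abs_mul, abs_two]
  gcongr
  exact abs_real_inner_le_norm _ _

end Virial

section HardyField

theorem abs_coord_le_norm (i : Fin 3) (y : R3) : |y i| ≤ ‖y‖ := by
  simpa using PiLp.norm_apply_le y i

theorem abs_coord_div_le {ε : ℝ} (hε : 0 < ε) (i : Fin 3) (y : R3) :
    |y i / (‖y‖ ^ 2 + ε)| ≤ 1 + 1 / ε := by
  rw [abs_div, abs_of_pos (by positivity : 0 < ‖y‖ ^ 2 + ε), div_le_iff₀ (by positivity)]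
  have h : (1 + 1 / ε) * (‖y‖ ^ 2 + ε) = ‖y‖ ^ 2 / ε + (‖y‖ ^ 2 + 1 + ε) := by
    field_simp
    ring
  have : 0 ≤ ‖y‖ ^ 2 / ε := by positivity
  nlinarith [abs_coord_le_norm i y, sq_nonneg (‖y‖ - 1)]

theorem abs_deriv_coord_div_le {ε : ℝ} (hε : 0 < ε) (i : Fin 3) (y : R3) :
    |(‖y‖ ^ 2 + ε - 2 * y i ^ 2) / (‖y‖ ^ 2 + ε) ^ 2| ≤ 1 / ε := by
  have hcoord : y i ^ 2 ≤ ‖y‖ ^ 2 := sq_le_sq.2 (by simpa using abs_coord_le_norm i y)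
  have hnum : |‖y‖ ^ 2 + ε - 2 * y i ^ 2| ≤ ‖y‖ ^ 2 + ε := by
    rw [abs_le]
    constructor <;> nlinarith [sq_nonneg (y i)]
  rw [abs_div, abs_of_pos (by positivity : 0 < (‖y‖ ^ 2 + ε) ^ 2),
    div_le_div_iff₀ (by positivity) hε, one_mul, sq (‖y‖ ^ 2 + ε)]
  exact mul_le_mul hnum (by nlinarith [sq_nonneg ‖y‖]) hε.le (by positivity)

variable {ε : ℝ} (hε : 0 < ε) (i : Fin 3)

/-- The `i`-th component of the regularization `y / (|y|² + ε)` of the field `y / |y|²` whose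
divergence gives Hardy's inequality. -/
def hardyField : BoundedContinuousFunction R3 ℝ :=
  BoundedContinuousFunction.ofNormedAddCommGroup (fun y => y i / (‖y‖ ^ 2 + ε))
    (Continuous.div (by fun_prop) (by fun_prop) fun y => by positivity) _ (abs_coord_div_le hε i)

/-- The `i`-th partial derivative of `hardyField hε i`. -/
def hardyFieldDeriv : BoundedContinuousFunction R3 ℝ :=
  BoundedContinuousFunction.ofNormedAddCommGroup
    (fun y => (‖y‖ ^ 2 + ε - 2 * y i ^ 2) / (‖y‖ ^ 2 + ε) ^ 2)
    (Continuous.div (by fun_prop) (by fun_prop) fun y => by positivity) _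
    (abs_deriv_coord_div_le hε i)

theorem norm_sq_sub_single (y : R3) (t : ℝ) :
    ‖y - EuclideanSpace.single i t‖ ^ 2 = ‖y‖ ^ 2 - 2 * t * y i + t ^ 2 := by
  rw [norm_sub_sq_real]
  simp [EuclideanSpace.inner_single_right]
  ring

theorem hasDerivAt_hardyField (y : R3) (t : ℝ) :
    HasDerivAt (fun t => hardyField hε i (y - EuclideanSpace.single i t))
      (-hardyFieldDeriv hε i (y - EuclideanSpace.single i t)) t := by
  have hnum : HasDerivAt (fun t : ℝ => y i - t) (-1) t := (hasDerivAt_id t).const_sub _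
  have hden : HasDerivAt (fun t : ℝ => ‖y‖ ^ 2 - 2 * t * y i + t ^ 2 + ε)
      (-(2 * y i) + 2 * t) t := by
    simpa using (((((hasDerivAt_id t).const_mul 2).mul_const (y i)).const_sub (‖y‖ ^ 2)).add
      (hasDerivAt_pow 2 t)).add_const ε
  have hpos : ‖y - EuclideanSpace.single i t‖ ^ 2 + ε ≠ 0 := by positivity
  rw [norm_sq_sub_single] at hpos
  refine ((hnum.div hden hpos).congr_deriv ?_).congr_of_eventuallyEq
    (Eventually.of_forall fun s => ?_)
  · simp only [hardyFieldDeriv, BoundedContinuousFunction.coe_ofNormedAddCommGroup,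
      norm_sq_sub_single, PiLp.sub_apply, PiLp.single_apply, if_true, ← neg_div]
    congr 1
    ring
  · simp [hardyField, norm_sq_sub_single]

theorem sum_hardyField_sq (y : R3) :
    ∑ i, hardyField hε i y ^ 2 = (‖y‖ / (‖y‖ ^ 2 + ε)) ^ 2 := by
  simp only [hardyField, BoundedContinuousFunction.coe_ofNormedAddCommGroup, div_pow,
    ← Finset.sum_div, EuclideanSpace.norm_sq_eq, Real.norm_eq_abs, sq_abs]

theorem sum_hardyField_sq_le_sum_hardyFieldDeriv (y : R3) :
    ∑ i, hardyField hε i y ^ 2 ≤ ∑ i, hardyFieldDeriv hε i y := by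
  have hdiv : ∑ i, hardyFieldDeriv hε i y = (‖y‖ ^ 2 + 3 * ε) / (‖y‖ ^ 2 + ε) ^ 2 := by
    have hsum : ‖y‖ ^ 2 = y 0 ^ 2 + y 1 ^ 2 + y 2 ^ 2 := by
      simp [EuclideanSpace.norm_sq_eq, Fin.sum_univ_three]
    simp only [hardyFieldDeriv, BoundedContinuousFunction.coe_ofNormedAddCommGroup,
      ← Finset.sum_div]
    congr 1
    rw [Fin.sum_univ_three, hsum]
    ring
  rw [hdiv, sum_hardyField_sq, div_pow]
  gcongr
  linarith

end HardyField

theorem integrable_and_integral_le_of_tendsto {X : Type*} [MeasurableSpace X] {μ : Measure X}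
    {F : ℕ → X → ℝ} {f : X → ℝ} {C : ℝ} (hF : ∀ k, Integrable (F k) μ) (hF0 : ∀ k x, 0 ≤ F k x)
    (hlim : ∀ x, Tendsto (F · x) atTop (𝓝 (f x))) (hC : ∀ k, ∫ x, F k x ∂μ ≤ C) :
    Integrable f μ ∧ ∫ x, f x ∂μ ≤ C := by
  have hf0 : 0 ≤ᵐ[μ] f := Eventually.of_forall fun x => ge_of_tendsto' (hlim x) (hF0 · x)
  have hmeas : AEStronglyMeasurable f μ :=
    aestronglyMeasurable_of_tendsto_ae atTop (fun k => (hF k).1) (Eventually.of_forall hlim)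
  have hfatou : ∫⁻ x, ENNReal.ofReal (f x) ∂μ ≤ ENNReal.ofReal C := calc
    _ = ∫⁻ x, liminf (fun k => ENNReal.ofReal (F k x)) atTop ∂μ :=
      lintegral_congr fun x => ((ENNReal.tendsto_ofReal (hlim x)).liminf_eq).symm
    _ ≤ liminf (fun k => ∫⁻ x, ENNReal.ofReal (F k x) ∂μ) atTop :=
      lintegral_liminf_le' fun k => (hF k).1.aemeasurable.ennreal_ofReal
    _ ≤ ENNReal.ofReal C := liminf_le_of_le (by isBoundedDefault) fun b hb => by
      obtain ⟨k, hk⟩ := hb.exists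
      rw [← ofReal_integral_eq_lintegral_ofReal (hF k) (Eventually.of_forall (hF0 k))] at hk
      exact hk.trans (ENNReal.ofReal_le_ofReal (hC k))
  refine ⟨⟨hmeas, (hasFiniteIntegral_iff_ofReal hf0).2 (hfatou.trans_lt ENNReal.ofReal_lt_top)⟩, ?_⟩
  rw [integral_eq_lintegral_of_nonneg_ae hf0 hmeas]
  exact ENNReal.toReal_le_of_le_ofReal ((integral_nonneg (hF0 0)).trans (hC 0)) hfatou

section Hardy

variable {ℓ : ℝ} [Fact (0 < ℓ)] {n : ℕ}

/-- The function `(x, y₁, …, yₙ) ↦ w(yⱼ)`. -/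
def phononWeight (ℓ : ℝ) (w : BoundedContinuousFunction R3 ℝ) (j : Fin n) :
    BoundedContinuousFunction (Conf ℓ n) ℝ :=
  w.compContinuous ⟨fun z => z.2 j, by fun_prop⟩

theorem integral_hardyFieldDeriv_le {ε : ℝ} (hε : 0 < ε) (j : Fin n) {i : Fin 3} {f g : L2 ℓ n}
    (h : (shiftGroup i).HasGenerator f g) :
    ∫ z, hardyFieldDeriv hε i (z.2 j) * ‖f z‖ ^ 2
      ≤ (1 / 2) * (∫ z, hardyField hε i (z.2 j) ^ 2 * ‖f z‖ ^ 2) + 2 * ‖g‖ ^ 2 := by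
  have hvirial := abs_integral_deriv_mul_norm_sq_le
    (w := phononWeight ℓ (hardyField hε i) j) (w' := -phononWeight ℓ (hardyFieldDeriv hε i) j)
    (fun z t => by
      simpa [phononWeight, shiftMap, displacement, ← sub_eq_add_neg] using
        hasDerivAt_hardyField hε i (z.2 j) t) h
  have hW : ∫ z, hardyField hε i (z.2 j) ^ 2 * ‖f z‖ ^ 2
      = ‖mulL2 volume (phononWeight ℓ (hardyField hε i) j) f‖ ^ 2 :=
    (norm_sq_mulL2 (phononWeight ℓ (hardyField hε i) j) f).symm
  simp only [BoundedContinuousFunction.neg_apply, neg_mul, integral_neg, abs_neg] at hvirial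
  rw [hW]
  refine (le_abs_self _).trans (hvirial.trans ?_)
  nlinarith [sq_nonneg (‖mulL2 volume (phononWeight ℓ (hardyField hε i) j) f‖ - 2 * ‖g‖)]

theorem hardy_regularized {ε : ℝ} (hε : 0 < ε) (j : Fin n) {f : L2 ℓ n} {g : Fin 3 → L2 ℓ n}
    (h : ∀ i, (shiftGroup i).HasGenerator f (g i)) :
    Integrable (fun z => (‖z.2 j‖ / (‖z.2 j‖ ^ 2 + ε)) ^ 2 * ‖f z‖ ^ 2) volume ∧
    ∫ z, (‖z.2 j‖ / (‖z.2 j‖ ^ 2 + ε)) ^ 2 * ‖f z‖ ^ 2 ≤ 4 * ∑ i, ‖g i‖ ^ 2 := by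
  have hinteg (i : Fin 3) :
      Integrable (fun z : Conf ℓ n => hardyField hε i (z.2 j) ^ 2 * ‖f z‖ ^ 2) :=
    integrable_mul_norm_sq (phononWeight ℓ (hardyField hε i) j ^ 2) f
  have hinteg' (i : Fin 3) :
      Integrable (fun z : Conf ℓ n => hardyFieldDeriv hε i (z.2 j) * ‖f z‖ ^ 2) :=
    integrable_mul_norm_sq (phononWeight ℓ (hardyFieldDeriv hε i) j) f
  simp only [← sum_hardyField_sq hε, Finset.sum_mul]
  refine ⟨integrable_finsetSum _ fun i _ => hinteg i, ?_⟩
  rw [integral_finsetSum _ fun i _ => hinteg i]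
  have hdiv : ∑ i, ∫ z, hardyField hε i (z.2 j) ^ 2 * ‖f z‖ ^ 2
      ≤ ∑ i, ∫ z, hardyFieldDeriv hε i (z.2 j) * ‖f z‖ ^ 2 := by
    rw [← integral_finsetSum _ fun i _ => hinteg i, ← integral_finsetSum _ fun i _ => hinteg' i]
    refine integral_mono (integrable_finsetSum _ fun i _ => hinteg i)
      (integrable_finsetSum _ fun i _ => hinteg' i) fun z => ?_
    simp only [← Finset.sum_mul]
    gcongr ?_ * _
    exact sum_hardyField_sq_le_sum_hardyFieldDeriv hε _
  have hvirial := Finset.sum_le_sum fun i (_ : i ∈ Finset.univ) =>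
    integral_hardyFieldDeriv_le hε j (h i)
  rw [Finset.sum_add_distrib, ← Finset.mul_sum, ← Finset.mul_sum] at hvirial
  linarith

theorem hardy (j : Fin n) {f : L2 ℓ n} {g : Fin 3 → L2 ℓ n}
    (h : ∀ i, (shiftGroup i).HasGenerator f (g i)) :
    Integrable (fun z => (‖f z‖ / ‖z.2 j‖) ^ 2) volume ∧
      ∫ z, (‖f z‖ / ‖z.2 j‖) ^ 2 ≤ 4 * ∑ i, ‖g i‖ ^ 2 := by
  have hε (k : ℕ) : 0 < 1 / ((k : ℝ) + 1) := Nat.one_div_pos_of_nat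
  refine integrable_and_integral_le_of_tendsto (fun k => (hardy_regularized (hε k) j h).1)
    (fun k z => by positivity) (fun z => ?_) (fun k => (hardy_regularized (hε k) j h).2)
  rcases eq_or_ne (z.2 j) 0 with h0 | h0
  · simp [h0]
  · have hne : ‖z.2 j‖ ≠ 0 := norm_ne_zero_iff.2 h0
    have hlim : Tendsto (fun k : ℕ => (‖z.2 j‖ / (‖z.2 j‖ ^ 2 + 1 / ((k : ℝ) + 1))) ^ 2) atTop
        (𝓝 ((‖z.2 j‖ / (‖z.2 j‖ ^ 2 + 0)) ^ 2)) :=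
      (tendsto_const_nhds.div (tendsto_const_nhds.add tendsto_one_div_add_atTop_nhds_zero_nat)
        (by simpa using h0)).pow 2
    convert hlim.mul_const (‖f z‖ ^ 2) using 2
    rw [add_zero]
    field_simp

end Hardy

theorem integral_mul_le_sqrt {X : Type*} [MeasurableSpace X] {μ : Measure X} {F G : X → ℝ}
    (hF : 0 ≤ F) (hG : 0 ≤ G) (hFm : AEStronglyMeasurable F μ) (hGm : AEStronglyMeasurable G μ)
    (hF2 : Integrable (fun x => F x ^ 2) μ) (hG2 : Integrable (fun x => G x ^ 2) μ) :
    Integrable (fun x => F x * G x) μ ∧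
      ∫ x, F x * G x ∂μ ≤ √(∫ x, F x ^ 2 ∂μ) * √(∫ x, G x ^ 2 ∂μ) := by
  have hFL : MemLp F 2 μ := (memLp_two_iff_integrable_sq hFm).2 hF2
  have hGL : MemLp G 2 μ := (memLp_two_iff_integrable_sq hGm).2 hG2
  refine ⟨hFL.integrable_mul hGL, ?_⟩
  have h := integral_mul_le_Lp_mul_Lq_of_nonneg (μ := μ) (p := 2) (q := 2)
    (by constructor <;> norm_num)
    (Eventually.of_forall hF) (Eventually.of_forall hG) (by simpa using hFL) (by simpa using hGL)
  simpa [Real.sqrt_eq_rpow] using h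

section Radial

/-- The part of `1 / |y|` inside the ball of radius `r`. -/
def nearPart (r : ℝ) (y : R3) : ℝ := if ‖y‖ < r then 1 / ‖y‖ else 0

/-- The part of `v` outside the ball of radius `r`. -/
def farPart (r : ℝ) (y : R3) : ℝ := if ‖y‖ < r then 0 else v y

theorem v_eq_near_add_far (r : ℝ) (y : R3) : v y = nearPart r y * (1 / ‖y‖) + farPart r y := by
  unfold v nearPart farPart
  split_ifs
  · rw [add_zero, div_mul_div_comm, one_mul, sq]
  · rw [zero_mul, zero_add]
    rfl

theorem nearPart_nonneg (r : ℝ) : 0 ≤ nearPart r := fun y => by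
  unfold nearPart
  split_ifs <;> simp

theorem v_nonneg (y : R3) : 0 ≤ v y := by
  unfold v
  positivity

theorem v_pos {y : R3} (hy : y ≠ 0) : 0 < v y := by
  unfold v
  have := norm_pos_iff.2 hy
  positivity

theorem farPart_nonneg (r : ℝ) : 0 ≤ farPart r := fun y => by
  unfold farPart
  split_ifs
  · simp
  · exact v_nonneg y

theorem measurable_v : Measurable v := by
  unfold v
  fun_prop

theorem measurable_nearPart (r : ℝ) : Measurable (nearPart r) :=
  Measurable.ite (measurableSet_lt measurable_norm measurable_const) (by fun_prop)
    measurable_const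

theorem measurable_farPart (r : ℝ) : Measurable (farPart r) :=
  Measurable.ite (measurableSet_lt measurable_norm measurable_const) measurable_const measurable_v

theorem nearPart_sq (r : ℝ) (y : R3) :
    nearPart r y ^ 2 = (fun s : ℝ => if s < r then (1 / s) ^ 2 else 0) ‖y‖ := by
  simp only [nearPart, ite_pow, zero_pow two_ne_zero]

theorem sq_smul_eqOn_indicator_Iio (r : ℝ) :
    Set.EqOn (fun s : ℝ => s ^ (Module.finrank ℝ R3 - 1) • (if s < r then (1 / s) ^ 2 else 0))
      (Set.indicator (Set.Iio r) fun _ => (1 : ℝ)) (Set.Ioi 0) := by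
  intro s hs
  by_cases h : s < r <;> simp [h, (Set.mem_Ioi.1 hs).ne']

theorem integrable_nearPart_sq (r : ℝ) : Integrable (fun y => nearPart r y ^ 2) volume := by
  simp only [nearPart_sq]
  refine (integrable_fun_norm_addHaar volume).2
    (IntegrableOn.congr_fun ?_ (sq_smul_eqOn_indicator_Iio r).symm measurableSet_Ioi)
  rw [integrableOn_indicator_iff measurableSet_Iio, Set.inter_comm, Set.Ioi_inter_Iio]
  exact integrableOn_const (by simp)

theorem integral_nearPart_sq {r : ℝ} (hr : 0 ≤ r) :
    ∫ y, nearPart r y ^ 2 = 3 * volume.real (Metric.ball (0 : R3) 1) * r := by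
  simp only [nearPart_sq r]
  rw [integral_fun_norm_addHaar volume fun s : ℝ => if s < r then (1 / s) ^ 2 else 0,
    setIntegral_congr_fun measurableSet_Ioi (sq_smul_eqOn_indicator_Iio r),
    setIntegral_indicator measurableSet_Iio, Set.Ioi_inter_Iio]
  simp [hr]
  ring

theorem exists_nearPart_small {δ : ℝ} (hδ : 0 < δ) : ∃ r > 0, √(∫ y, nearPart r y ^ 2) ≤ δ := by
  set K := 3 * volume.real (Metric.ball (0 : R3) 1)
  have hr : 0 < δ ^ 2 / (K + 1) := by positivity
  refine ⟨δ ^ 2 / (K + 1), hr, ?_⟩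
  rw [integral_nearPart_sq hr.le]
  refine Real.sqrt_le_iff.2 ⟨hδ.le, ?_⟩
  rw [← mul_div_assoc, div_le_iff₀ (by positivity)]
  nlinarith [sq_nonneg δ]

theorem farPart_sq_le {r : ℝ} (hr : 0 < r) (y : R3) :
    farPart r y ^ 2 ≤ (1 + 1 / r) ^ 4 * (1 + ‖y‖) ^ (-(4 : ℝ)) := by
  unfold farPart v
  split_ifs with hy
  · rw [zero_pow two_ne_zero]
    positivity
  · have hle : r ≤ ‖y‖ := not_lt.1 hy
    have hpos : 0 < ‖y‖ := hr.trans_le hle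
    have hlin : 1 + ‖y‖ ≤ (1 + 1 / r) * ‖y‖ := by
      have : 1 ≤ ‖y‖ / r := (one_le_div hr).2 hle
      linarith [show (1 + 1 / r) * ‖y‖ = ‖y‖ + ‖y‖ / r by ring]
    rw [Real.rpow_neg (by positivity), ← div_eq_mul_inv, div_pow, one_pow, ← pow_mul,
      div_le_div_iff₀ (by positivity) (by positivity), one_mul, ← mul_pow]
    exact_mod_cast pow_le_pow_left₀ (by positivity) hlin 4

theorem integrable_farPart_sq {r : ℝ} (hr : 0 < r) :
    Integrable (fun y => farPart r y ^ 2) volume := by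
  have hdecay : Integrable (fun y : R3 => (1 + 1 / r) ^ 4 * (1 + ‖y‖) ^ (-(4 : ℝ))) volume :=
    (integrable_one_add_norm (by simp; norm_num)).const_mul _
  refine hdecay.mono' ((measurable_farPart r).pow_const 2).aestronglyMeasurable
    (Eventually.of_forall fun y => ?_)
  rw [Real.norm_of_nonneg (sq_nonneg _)]
  exact farPart_sq_le hr y

end Radial

section Pairing

variable {ℓ : ℝ} {n : ℕ}

/-- Adding a phonon at the last place of a configuration. -/
def snocMap (p : Conf ℓ n × R3) : Conf ℓ (n + 1) :=
  (p.1.1, Fin.snoc (α := fun _ => R3) p.1.2 p.2)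

/-- `snocMap` as a measurable equivalence. -/
def snocEquiv (ℓ : ℝ) (n : ℕ) : Conf ℓ n × R3 ≃ᵐ Conf ℓ (n + 1) :=
  MeasurableEquiv.prodAssoc.trans <| MeasurableEquiv.prodCongr (MeasurableEquiv.refl _) <|
    MeasurableEquiv.prodComm.trans (MeasurableEquiv.piFinSuccAbove (fun _ => R3) (Fin.last n)).symm

theorem coe_snocEquiv : ⇑(snocEquiv ℓ n) = snocMap := by
  funext p
  refine Prod.ext rfl ?_
  exact Fin.insertNth_last' p.2 p.1.2

theorem snocMap_last (p : Conf ℓ n × R3) : (snocMap p).2 (Fin.last n) = p.2 := by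
  simp [snocMap]

theorem measurableEmbedding_snocMap : MeasurableEmbedding (snocMap (ℓ := ℓ) (n := n)) := by
  rw [← coe_snocEquiv]
  exact (snocEquiv ℓ n).measurableEmbedding

variable [Fact (0 < ℓ)]

theorem snocMap_preserving : MeasurePreserving (snocMap (ℓ := ℓ) (n := n)) volume volume := by
  rw [← coe_snocEquiv]
  have h1 : MeasurePreserving
      (MeasurableEquiv.prodAssoc : (Torus ℓ × (Fin n → R3)) × R3 ≃ᵐ _) volume volume :=
    measurePreserving_prodAssoc volume volume volume
  have h2 : MeasurePreserving (MeasurableEquiv.prodComm : (Fin n → R3) × R3 ≃ᵐ _)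
      volume volume := Measure.measurePreserving_swap
  have h3 : MeasurePreserving
      (MeasurableEquiv.piFinSuccAbove (fun _ : Fin (n + 1) => R3) (Fin.last n)).symm
      volume volume :=
    (volume_preserving_piFinSuccAbove (fun _ : Fin (n + 1) => R3) (Fin.last n)).symm
  exact (((MeasurePreserving.id (volume : Measure (Torus ℓ))).prod (h3.comp h2))).comp h1

/-- The integrand of the pairing `⟨φ, a(v) ψ⟩`. -/
def pairKernel (φ : L2 ℓ n) (ψ : L2 ℓ (n + 1)) (p : Conf ℓ n × R3) : ℂ :=
  starRingEnd ℂ (φ p.1) * ((v p.2 : ℂ) * ψ (snocMap p))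

/-- The pairing `∫ conj φ(x, y₁, …, yₙ) v(y) ψ(x, y₁, …, yₙ, y)`. -/
def pair (φ : L2 ℓ n) (ψ : L2 ℓ (n + 1)) : ℂ := ∫ p, pairKernel φ ψ p

theorem aestronglyMeasurable_comp_fst (φ : L2 ℓ n) :
    AEStronglyMeasurable (fun p : Conf ℓ n × R3 => φ p.1) volume :=
  (Lp.aestronglyMeasurable φ).comp_quasiMeasurePreserving Measure.quasiMeasurePreserving_fst

theorem aestronglyMeasurable_comp_snocMap (ψ : L2 ℓ (n + 1)) :
    AEStronglyMeasurable (fun p : Conf ℓ n × R3 => ψ (snocMap p)) volume :=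
  (Lp.aestronglyMeasurable ψ).comp_quasiMeasurePreserving
    snocMap_preserving.quasiMeasurePreserving

theorem ae_comp_fst {P : Conf ℓ n → Prop} (h : ∀ᵐ z, P z) : ∀ᵐ p : Conf ℓ n × R3, P p.1 :=
  Measure.quasiMeasurePreserving_fst.ae h

theorem ae_comp_snocMap {P : Conf ℓ (n + 1) → Prop} (h : ∀ᵐ z, P z) :
    ∀ᵐ p : Conf ℓ n × R3, P (snocMap p) :=
  snocMap_preserving.quasiMeasurePreserving.ae h

theorem ae_ne_zero_snd : ∀ᵐ p : Conf ℓ n × R3, p.2 ≠ 0 := by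
  refine (Measure.quasiMeasurePreserving_snd (μ := (volume : Measure (Conf ℓ n)))).ae
    (p := fun y : R3 => y ≠ 0) ?_
  exact compl_mem_ae_iff.2 (measure_singleton (0 : R3))

theorem aestronglyMeasurable_pairKernel (φ : L2 ℓ n) (ψ : L2 ℓ (n + 1)) :
    AEStronglyMeasurable (pairKernel φ ψ) volume :=
  (Complex.continuous_conj.comp_aestronglyMeasurable (aestronglyMeasurable_comp_fst φ)).mul
    ((Complex.continuous_ofReal.comp_aestronglyMeasurable
      (measurable_v.comp measurable_snd).aestronglyMeasurable).mul
        (aestronglyMeasurable_comp_snocMap ψ))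

theorem norm_pairKernel (r : ℝ) (φ : L2 ℓ n) (ψ : L2 ℓ (n + 1)) (p : Conf ℓ n × R3) :
    ‖pairKernel φ ψ p‖ = ‖φ p.1‖ * nearPart r p.2 * (‖ψ (snocMap p)‖ / ‖p.2‖)
      + ‖φ p.1‖ * farPart r p.2 * ‖ψ (snocMap p)‖ := by
  simp only [pairKernel, norm_mul, RCLike.norm_conj, Complex.norm_real, Real.norm_eq_abs,
    abs_of_nonneg (v_nonneg _)]
  rw [v_eq_near_add_far r]
  ring

theorem integral_norm_mul_mul_le (φ : L2 ℓ n) {k : R3 → ℝ} (hk : 0 ≤ k) (hkm : Measurable k)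
    (hk2 : Integrable (fun y => k y ^ 2)) {G : Conf ℓ n × R3 → ℝ} (hG : 0 ≤ G)
    (hGm : AEStronglyMeasurable G) (hG2 : Integrable (fun p => G p ^ 2)) :
    Integrable (fun p => ‖φ p.1‖ * k p.2 * G p) ∧
      ∫ p, ‖φ p.1‖ * k p.2 * G p ≤ ‖φ‖ * √(∫ y, k y ^ 2) * √(∫ p, G p ^ 2) := by
  have hinteg : Integrable (fun p : Conf ℓ n × R3 => (‖φ p.1‖ * k p.2) ^ 2) := by
    simp only [mul_pow]
    exact (integrable_norm_sq φ).mul_prod hk2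
  have hnorm : √(∫ p : Conf ℓ n × R3, (‖φ p.1‖ * k p.2) ^ 2) = ‖φ‖ * √(∫ y, k y ^ 2) := by
    have hprod := integral_prod_mul (μ := (volume : Measure (Conf ℓ n)))
      (ν := (volume : Measure R3)) (fun z => ‖φ z‖ ^ 2) (fun y => k y ^ 2)
    simp only [mul_pow]
    rw [Measure.volume_eq_prod, hprod, ← L2_norm_sq_eq_integral, Real.sqrt_mul (by positivity),
      Real.sqrt_sq (norm_nonneg _)]
  rw [← hnorm]
  exact integral_mul_le_sqrt (fun p => mul_nonneg (norm_nonneg _) (hk _)) hG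
    ((aestronglyMeasurable_comp_fst φ).norm.mul (hkm.comp measurable_snd).aestronglyMeasurable)
    hGm hinteg hG2

theorem integral_norm_comp_snocMap_sq (ψ : L2 ℓ (n + 1)) :
    Integrable (fun p : Conf ℓ n × R3 => ‖ψ (snocMap p)‖ ^ 2) ∧
      ∫ p : Conf ℓ n × R3, ‖ψ (snocMap p)‖ ^ 2 = ‖ψ‖ ^ 2 :=
  ⟨(snocMap_preserving.integrable_comp_emb measurableEmbedding_snocMap).2 (integrable_norm_sq ψ),
    (snocMap_preserving.integral_comp measurableEmbedding_snocMap fun z => ‖ψ z‖ ^ 2).trans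
      (L2_norm_sq_eq_integral ψ).symm⟩

theorem hardy_comp_snocMap {ψ : L2 ℓ (n + 1)} {g : Fin 3 → L2 ℓ (n + 1)}
    (h : ∀ i, (shiftGroup i).HasGenerator ψ (g i)) :
    Integrable (fun p : Conf ℓ n × R3 => (‖ψ (snocMap p)‖ / ‖p.2‖) ^ 2) ∧
      ∫ p : Conf ℓ n × R3, (‖ψ (snocMap p)‖ / ‖p.2‖) ^ 2 ≤ 4 * ∑ i, ‖g i‖ ^ 2 := by
  obtain ⟨hinteg, hle⟩ := hardy (Fin.last n) h
  have hcomp := snocMap_preserving.integral_comp measurableEmbedding_snocMap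
    fun z => (‖ψ z‖ / ‖z.2 (Fin.last n)‖) ^ 2
  simp only [snocMap_last] at hcomp
  refine ⟨?_, hcomp.trans_le hle⟩
  simpa only [Function.comp_def, snocMap_last] using
    (snocMap_preserving.integrable_comp_emb measurableEmbedding_snocMap).2 hinteg

-- Hardy's inequality controls the singularity of `v`, at a cost that is small with the radius.
theorem pairKernel_bound {δ : ℝ} (hδ : 0 < δ) : ∃ b : ℝ, 0 ≤ b ∧
    ∀ (ℓ : ℝ) [Fact (0 < ℓ)] (n : ℕ) (φ : L2 ℓ n) (ψ : L2 ℓ (n + 1)) (g : Fin 3 → L2 ℓ (n + 1)),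
      (∀ i, (shiftGroup i).HasGenerator ψ (g i)) →
      Integrable (pairKernel φ ψ) volume ∧
        ∫ p, ‖pairKernel φ ψ p‖ ≤ ‖φ‖ * (δ * √(∑ i, ‖g i‖ ^ 2) + b * ‖ψ‖) := by
  obtain ⟨r, hr, hsmall⟩ := exists_nearPart_small (half_pos hδ)
  refine ⟨√(∫ y, farPart r y ^ 2), by positivity, fun ℓ _ n φ ψ g hg => ?_⟩
  have hψm := (aestronglyMeasurable_comp_snocMap ψ).norm
  obtain ⟨hψ, hψ_eq⟩ := integral_norm_comp_snocMap_sq ψ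
  obtain ⟨hquot, hquot_le⟩ := hardy_comp_snocMap hg
  have hquotm : AEStronglyMeasurable (fun p : Conf ℓ n × R3 => ‖ψ (snocMap p)‖ / ‖p.2‖) :=
    (hψm.aemeasurable.div measurable_snd.norm.aemeasurable).aestronglyMeasurable
  obtain ⟨hnear, hnear_le⟩ := integral_norm_mul_mul_le φ (nearPart_nonneg r)
    (measurable_nearPart r) (integrable_nearPart_sq r) (fun p => by positivity) hquotm hquot
  obtain ⟨hfar, hfar_le⟩ := integral_norm_mul_mul_le φ (farPart_nonneg r) (measurable_farPart r)
    (integrable_farPart_sq hr) (fun p => norm_nonneg _) hψm hψ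
  have hgrad : √(∫ p : Conf ℓ n × R3, (‖ψ (snocMap p)‖ / ‖p.2‖) ^ 2)
      ≤ 2 * √(∑ i, ‖g i‖ ^ 2) := by
    refine (Real.sqrt_le_sqrt hquot_le).trans_eq ?_
    rw [Real.sqrt_mul (by norm_num), show (4 : ℝ) = 2 ^ 2 by norm_num,
      Real.sqrt_sq (by norm_num)]
  rw [hψ_eq, Real.sqrt_sq (norm_nonneg _)] at hfar_le
  constructor
  · rw [← integrable_norm_iff (aestronglyMeasurable_pairKernel φ ψ)]
    simp only [norm_pairKernel r]
    exact hnear.add hfar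
  · simp only [norm_pairKernel r]
    rw [integral_add hnear hfar]
    calc _ ≤ ‖φ‖ * (δ / 2) * (2 * √(∑ i, ‖g i‖ ^ 2)) + ‖φ‖ * √(∫ y, farPart r y ^ 2) * ‖ψ‖ := by
            grw [hnear_le, hfar_le, hsmall, hgrad]
      _ = _ := by ring

end Pairing

section HilbertSum

variable {ι : Type*} {G : ι → Type*} [∀ i, NormedAddCommGroup (G i)]

theorem lp_two_hasSum_norm_sq (f : lp G 2) : HasSum (fun i => ‖f i‖ ^ 2) (‖f‖ ^ 2) := by
  simpa using lp.hasSum_norm (p := 2) (by norm_num) f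

theorem memℓp_two_of_summable {f : ∀ i, G i} (h : Summable fun i => ‖f i‖ ^ 2) : Memℓp f 2 :=
  memℓp_gen (by simpa using h)

end HilbertSum

section SectorGraph

variable {ℓ : ℝ} [Fact (0 < ℓ)] {n : ℕ}

/-- The graph of `f ↦ (f, √n f, ∂₁ f, ∂₂ f, ∂₃ f)` on the `n`-phonon sector, where
`∂ᵢ = grad i`. Its norm is the graph norm of the square root of `(-i∇ₓ - P_f)² + N`. -/
def sectorGraph (ℓ : ℝ) [Fact (0 < ℓ)] (n : ℕ) :
    Submodule ℂ (PiLp 2 fun _ : Fin 2 ⊕ Fin 3 => L2 ℓ n) where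
  carrier := {p | p (.inl 0) ∈ nPhonon ℓ n ∧ p (.inl 1) = (√n : ℂ) • p (.inl 0) ∧
    ∀ i, (shiftGroup i).HasGenerator (p (.inl 0)) (p (.inr i))}
  add_mem' hp hq := ⟨add_mem hp.1 hq.1,
    by rw [PiLp.add_apply, PiLp.add_apply, hp.2.1, hq.2.1, smul_add],
    fun i => (hp.2.2 i).add (hq.2.2 i)⟩
  zero_mem' := ⟨zero_mem _, (smul_zero _).symm, fun _ => .zero⟩
  smul_mem' c p hp := ⟨Submodule.smul_mem _ c hp.1,
    by rw [PiLp.smul_apply, PiLp.smul_apply, hp.2.1, smul_comm],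
    fun i => hasGenerator_smul c (hp.2.2 i)⟩

theorem isClosed_sectorGraph :
    IsClosed (sectorGraph ℓ n : Set (PiLp 2 fun _ : Fin 2 ⊕ Fin 3 => L2 ℓ n)) := by
  have hcont (k) : Continuous fun p : PiLp 2 fun _ : Fin 2 ⊕ Fin 3 => L2 ℓ n => p k :=
    PiLp.continuous_apply 2 _ k
  have hscaled : IsClosed {p : PiLp 2 fun _ : Fin 2 ⊕ Fin 3 => L2 ℓ n |
      p (.inl 1) = (√n : ℂ) • p (.inl 0)} :=
    isClosed_eq (hcont _) ((hcont _).const_smul (√n : ℂ))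
  have hgenerator : IsClosed {p : PiLp 2 fun _ : Fin 2 ⊕ Fin 3 => L2 ℓ n |
      ∀ i, (shiftGroup i).HasGenerator (p (.inl 0)) (p (.inr i))} := by
    simp only [Set.ofPred_forall]
    exact isClosed_iInter fun i => (shiftGroup i).isClosed_hasGenerator.preimage
      ((hcont (.inl 0)).prodMk (hcont (.inr i)))
  exact (isClosed_nPhonon.preimage (hcont (.inl 0))).inter (hscaled.inter hgenerator)

/-- The graph `sectorGraph` as a Hilbert space: the `n`-phonon functions of finite kinetic energy,
with the form norm. -/
def Sector (ℓ : ℝ) [Fact (0 < ℓ)] (n : ℕ) : Type := sectorGraph ℓ n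

namespace Sector

instance : NormedAddCommGroup (Sector ℓ n) :=
  inferInstanceAs (NormedAddCommGroup (sectorGraph ℓ n))

instance : InnerProductSpace ℂ (Sector ℓ n) :=
  inferInstanceAs (InnerProductSpace ℂ (sectorGraph ℓ n))

instance : CompleteSpace (Sector ℓ n) := isClosed_sectorGraph.completeSpace_coe

/-- The function represented by an element of the sector graph. -/
def fn (p : Sector ℓ n) : L2 ℓ n := p.1 (.inl 0)

/-- The gradient recorded by an element of the sector graph. -/
def gradient (p : Sector ℓ n) (i : Fin 3) : L2 ℓ n := p.1 (.inr i)

theorem fn_mem (p : Sector ℓ n) : p.fn ∈ nPhonon ℓ n := p.2.1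

theorem hasGenerator_fn (p : Sector ℓ n) (i : Fin 3) :
    (shiftGroup i).HasGenerator p.fn (p.gradient i) := p.2.2.2 i

theorem gradient_eq_grad (p : Sector ℓ n) (i : Fin 3) : p.gradient i = grad i p.fn :=
  (p.hasGenerator_fn i).deriv.symm

theorem fn_add (p q : Sector ℓ n) : (p + q).fn = p.fn + q.fn := rfl

theorem fn_smul (c : ℂ) (p : Sector ℓ n) : (c • p).fn = c • p.fn := rfl

theorem fn_zero : (0 : Sector ℓ n).fn = 0 := rfl

theorem inner_eq (p q : Sector ℓ n) : ⟪p, q⟫_ℂ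
    = ⟪p.fn, q.fn⟫_ℂ + ((∑ i, ⟪p.gradient i, q.gradient i⟫_ℂ) + n * ⟪p.fn, q.fn⟫_ℂ) := by
  have hsum : ⟪p, q⟫_ℂ = ∑ k, ⟪p.1 k, q.1 k⟫_ℂ :=
    (Submodule.coe_inner (sectorGraph ℓ n) p q).trans (PiLp.inner_apply p.1 q.1)
  rw [hsum, Fintype.sum_sum_type, Fin.sum_univ_two, p.2.2.1, q.2.2.1, inner_smul_left,
    inner_smul_right, ← mul_assoc, Complex.conj_ofReal, ← Complex.ofReal_mul,
    Real.mul_self_sqrt (Nat.cast_nonneg n), Complex.ofReal_natCast, add_assoc]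
  exact congrArg _ (add_comm _ _)

theorem norm_sq_eq (p : Sector ℓ n) :
    ‖p‖ ^ 2 = ‖p.fn‖ ^ 2 + ((∑ i, ‖p.gradient i‖ ^ 2) + n * ‖p.fn‖ ^ 2) := by
  have h := inner_eq p p
  simp only [inner_self_eq_norm_sq_to_K, Complex.coe_algebraMap] at h
  exact_mod_cast h

theorem norm_fn_le (p : Sector ℓ n) : ‖p.fn‖ ≤ ‖p‖ := by
  refine le_of_sq_le_sq ?_ (norm_nonneg _)
  rw [norm_sq_eq]
  exact le_add_of_nonneg_right (by positivity)

/-- `Sector.fn` as a contraction into the symmetric functions. -/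
def fnCLM : Sector ℓ n →L[ℂ] nPhonon ℓ n :=
  LinearMap.mkContinuous
    { toFun := fun p => ⟨p.fn, p.fn_mem⟩, map_add' := fun _ _ => rfl, map_smul' := fun _ _ => rfl }
    1 fun p => (p.norm_fn_le).trans_eq (one_mul _).symm

theorem norm_fnCLM_le : ‖(fnCLM : Sector ℓ n →L[ℂ] nPhonon ℓ n)‖ ≤ 1 :=
  LinearMap.mkContinuous_norm_le _ zero_le_one _

/-- The element of the sector graph with a given function and gradient. -/
def mk (f : L2 ℓ n) (hf : f ∈ nPhonon ℓ n) (g : Fin 3 → L2 ℓ n)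
    (hg : ∀ i, (shiftGroup i).HasGenerator f (g i)) : Sector ℓ n :=
  ⟨WithLp.toLp 2 (Sum.elim ![f, (√n : ℂ) • f] g), hf, rfl, hg⟩

theorem fn_mk (f : L2 ℓ n) (hf : f ∈ nPhonon ℓ n) (g : Fin 3 → L2 ℓ n)
    (hg : ∀ i, (shiftGroup i).HasGenerator f (g i)) : (mk f hf g hg).fn = f := rfl

theorem gradient_mk (f : L2 ℓ n) (hf : f ∈ nPhonon ℓ n) (g : Fin 3 → L2 ℓ n)
    (hg : ∀ i, (shiftGroup i).HasGenerator f (g i)) (i : Fin 3) :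
    (mk f hf g hg).gradient i = g i := rfl

theorem fn_injective : Function.Injective (fn : Sector ℓ n → L2 ℓ n) := by
  intro p q h
  refine Subtype.ext (PiLp.ext fun k => ?_)
  rcases k with k | i
  · fin_cases k
    · exact h
    · exact p.2.2.1.trans ((congrArg _ h).trans q.2.2.1.symm)
  · exact (gradient_eq_grad p i).trans ((congrArg _ h).trans (gradient_eq_grad q i).symm)

end Sector

end SectorGraph

section FormSpace

variable {ℓ : ℝ} [Fact (0 < ℓ)]

theorem Hilb_ext {Φ Ψ : Hilb ℓ} (h : ∀ n, comp Φ n = comp Ψ n) : Φ = Ψ :=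
  lp.ext (funext fun n => Subtype.ext (h n))

theorem hasSum_norm_comp_sq (Ψ : Hilb ℓ) : HasSum (fun n => ‖comp Ψ n‖ ^ 2) (‖Ψ‖ ^ 2) :=
  lp_two_hasSum_norm_sq Ψ

theorem hasSum_inner_comp (Φ Ψ : Hilb ℓ) :
    HasSum (fun n => ⟪comp Φ n, comp Ψ n⟫_ℂ) ⟪Φ, Ψ⟫_ℂ :=
  lp.hasSum_inner Φ Ψ

/-- The form domain with its form norm, as a Hilbert space. -/
abbrev FormSpace (ℓ : ℝ) [Fact (0 < ℓ)] : Type := lp (fun n : ℕ => Sector ℓ n) 2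

/-- The embedding of the form space into the Hilbert space. -/
def embed (ℓ : ℝ) [Fact (0 < ℓ)] : FormSpace ℓ →L[ℂ] Hilb ℓ :=
  lp.mapCLM 2 (fun _ => Sector.fnCLM) zero_le_one fun _ => Sector.norm_fnCLM_le

theorem comp_embed (p : FormSpace ℓ) (n : ℕ) : comp (embed ℓ p) n = (p n).fn := rfl

theorem norm_embed_le (p : FormSpace ℓ) : ‖embed ℓ p‖ ≤ ‖p‖ :=
  ((embed ℓ).le_of_opNorm_le (lp.norm_mapCLM_le 2 _ zero_le_one _) p).trans_eq (one_mul _)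

theorem mem_FormDomain_iff (Ψ : Hilb ℓ) : Ψ ∈ FormDomain ℓ ↔ ∃ p, embed ℓ p = Ψ := by
  constructor
  · rintro ⟨hgrad, henergy⟩
    let q (n : ℕ) : Sector ℓ n := .mk (comp Ψ n) (Ψ n).2 (fun i => grad i (comp Ψ n))
      (fun i => (hgrad n i).hasGenerator)
    have hq : Memℓp q 2 := memℓp_two_of_summable <|
      ((hasSum_norm_comp_sq Ψ).summable.add henergy).congr fun n => ((q n).norm_sq_eq).symm
    exact ⟨⟨q, hq⟩, Hilb_ext fun n => rfl⟩
  · rintro ⟨p, rfl⟩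
    refine ⟨fun n i => ((p n).hasGenerator_fn i).differentiableAt,
      .of_nonneg_of_le (fun n => by positivity) (fun n => ?_)
        (lp_two_hasSum_norm_sq p).summable⟩
    rw [Sector.norm_sq_eq]
    simp only [comp_embed, Sector.gradient_eq_grad]
    exact le_add_of_nonneg_left (sq_nonneg _)

end FormSpace

section CoerciveForm

variable {V H : Type*} [NormedAddCommGroup V] [InnerProductSpace ℂ V]
  [NormedAddCommGroup H] [InnerProductSpace ℂ H]

/-- Coercivity of the quadratic form of a bounded operator. -/
def IsCoerciveOperator (S : V →L[ℂ] V) : Prop :=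
  ∃ c : ℝ, 0 < c ∧ ∀ p, c * ‖p‖ ^ 2 ≤ (⟪p, S p⟫_ℂ).re

theorem IsCoerciveOperator.eq_zero {S : V →L[ℂ] V} (hS : IsCoerciveOperator S) {p : V}
    (hp : (⟪p, S p⟫_ℂ).re ≤ 0) : p = 0 := by
  obtain ⟨c, hc, hco⟩ := hS
  have hsq : ‖p‖ ^ 2 ≤ 0 := nonpos_of_mul_nonpos_right ((hco p).trans hp) hc
  simpa using le_antisymm hsq (sq_nonneg _)

/-- `p` solves `A p = f` weakly, where the form of `A` is `⟨·, S ·⟩` on the form space `V`, which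
is mapped into the Hilbert space by `J`. -/
def IsWeakSolution (J : V →L[ℂ] H) (S : V →L[ℂ] V) (p : V) (f : H) : Prop :=
  ∀ q, ⟪q, S p⟫_ℂ = ⟪J q, f⟫_ℂ

theorem IsWeakSolution.unique {J : V →L[ℂ] H} {S : V →L[ℂ] V} (hS : IsCoerciveOperator S)
    {p q : V} {f : H} (hp : IsWeakSolution J S p f) (hq : IsWeakSolution J S q f) : p = q := by
  refine sub_eq_zero.1 (hS.eq_zero (le_of_eq ?_))
  rw [map_sub, inner_sub_right, hp, hq, sub_self, Complex.zero_re]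

/-- The solution minimizes the energy `⟨q, S q⟩ - 2 Re ⟨J q, f⟩`, so a competitor that does not
have larger energy must coincide with it. -/
theorem IsWeakSolution.eq_of_energy_le {J : V →L[ℂ] H} {S : V →L[ℂ] V}
    (hS : IsCoerciveOperator S) (hsymm : ∀ p q, ⟪S p, q⟫_ℂ = ⟪p, S q⟫_ℂ) {f : H} {p q : V}
    (hp : IsWeakSolution J S p f) (hquad : (⟪q, S q⟫_ℂ).re ≤ (⟪p, S p⟫_ℂ).re)
    (hlin : (⟪J p, f⟫_ℂ).re ≤ (⟪J q, f⟫_ℂ).re) : q = p := by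
  have hcross : ⟪p, S q⟫_ℂ = starRingEnd ℂ ⟪J q, f⟫_ℂ := by
    rw [← hp, ← hsymm, inner_conj_symm]
  have henergy : (⟪q - p, S (q - p)⟫_ℂ).re
      = (⟪q, S q⟫_ℂ).re - 2 * (⟪J q, f⟫_ℂ).re + (⟪J p, f⟫_ℂ).re := by
    rw [map_sub, inner_sub_left, inner_sub_right, inner_sub_right, hp, hp, hcross]
    simp only [Complex.sub_re, Complex.conj_re]
    ring
  rw [hp] at hquad
  exact sub_eq_zero.1 (hS.eq_zero (by linarith))

variable [CompleteSpace V]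

theorem IsCoerciveOperator.isUnit {S : V →L[ℂ] V} (hS : IsCoerciveOperator S) : IsUnit S := by
  obtain ⟨c, hc, hco⟩ := hS
  refine ContinuousLinearMap.isUnit_of_forall_le_norm_inner_map S (c := ⟨c, hc.le⟩) hc
    fun p => ?_
  calc ‖p‖ ^ 2 * c = c * ‖p‖ ^ 2 := mul_comm _ _
    _ ≤ (⟪p, S p⟫_ℂ).re := hco p
    _ ≤ ‖⟪p, S p⟫_ℂ‖ := Complex.re_le_norm _
    _ = ‖⟪S p, p⟫_ℂ‖ := norm_inner_symm _ _

variable [CompleteSpace H]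

theorem exists_isPositive_forall_isWeakSolution (J : V →L[ℂ] H) {S : V →L[ℂ] V}
    (hS : IsCoerciveOperator S) (hsymm : ∀ p q, ⟪S p, q⟫_ℂ = ⟪p, S q⟫_ℂ) :
    ∃ R : H →L[ℂ] H, R.IsPositive ∧ ∀ f, ∃ p, R f = J p ∧ IsWeakSolution J S p f := by
  obtain ⟨u, hu⟩ := hS.isUnit
  obtain ⟨T, hT⟩ : ∃ T : V →L[ℂ] V, ∀ p, S (T p) = p :=
    ⟨↑u⁻¹, fun p => hu ▸ congrArg (fun A : V →L[ℂ] V => A p) u.mul_inv⟩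
  have hsol : ∀ f, IsWeakSolution J S (T (J.adjoint f)) f := fun f q => by
    rw [hT, ContinuousLinearMap.adjoint_inner_right]
  refine ⟨J ∘L T ∘L J.adjoint, ?_, fun f => ⟨T (J.adjoint f), rfl, hsol f⟩⟩
  rw [ContinuousLinearMap.isPositive_iff_complex]
  intro f
  set p := T (J.adjoint f)
  have hquad : ⟪J p, f⟫_ℂ = ⟪p, S p⟫_ℂ := (hsol f p).symm
  change ((⟪J p, f⟫_ℂ).re : ℂ) = ⟪J p, f⟫_ℂ ∧ 0 ≤ (⟪J p, f⟫_ℂ).re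
  rw [hquad]
  refine ⟨Complex.conj_eq_iff_re.1 ((inner_conj_symm _ _).trans (hsymm p p)), ?_⟩
  obtain ⟨c, hc, hco⟩ := hS
  exact le_trans (by positivity) (hco p)

end CoerciveForm

theorem tsum_mul_le_of_sq {a c : ℕ → ℝ} {A C : ℝ} (ha : ∀ n, 0 ≤ a n) (hc : ∀ n, 0 ≤ c n)
    (hA : 0 ≤ A) (hC : 0 ≤ C) (hsa : Summable fun n => a n ^ 2) (hsc : Summable fun n => c n ^ 2)
    (hAa : ∑' n, a n ^ 2 ≤ A ^ 2) (hCc : ∑' n, c n ^ 2 ≤ C ^ 2) :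
    Summable (fun n => a n * c n) ∧ ∑' n, a n * c n ≤ A * C := by
  have h := Real.summable_and_inner_le_Lp_mul_Lq_tsum_of_nonneg (p := 2) (q := 2)
    (by constructor <;> norm_num) ha hc (by simpa using hsa) (by simpa using hsc)
  refine ⟨h.1, h.2.trans ?_⟩
  simp only [Real.rpow_two, ← Real.sqrt_eq_rpow]
  exact mul_le_mul (Real.sqrt_le_iff.2 ⟨hA, hAa⟩) (Real.sqrt_le_iff.2 ⟨hC, hCc⟩)
    (Real.sqrt_nonneg _) hA

section Interaction

variable {ℓ : ℝ} [Fact (0 < ℓ)] {n : ℕ}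

theorem integrable_pairKernel (φ : L2 ℓ n) (q : Sector ℓ (n + 1)) :
    Integrable (pairKernel φ q.fn) volume := by
  obtain ⟨b, -, hb⟩ := pairKernel_bound one_pos
  exact (hb ℓ n φ q.fn q.gradient q.hasGenerator_fn).1

theorem pair_add_left (φ φ' : L2 ℓ n) (q : Sector ℓ (n + 1)) :
    pair (φ + φ') q.fn = pair φ q.fn + pair φ' q.fn := by
  unfold pair
  rw [← integral_add (integrable_pairKernel φ q) (integrable_pairKernel φ' q)]
  refine integral_congr_ae ?_
  filter_upwards [ae_comp_fst (Lp.coeFn_add φ φ')] with p hp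
  simp only [pairKernel, hp, Pi.add_apply, map_add]
  ring

theorem pair_smul_left (c : ℂ) (φ : L2 ℓ n) (ψ : L2 ℓ (n + 1)) :
    pair (c • φ) ψ = starRingEnd ℂ c * pair φ ψ := by
  unfold pair
  rw [← integral_const_mul]
  refine integral_congr_ae ?_
  filter_upwards [ae_comp_fst (Lp.coeFn_smul c φ)] with p hp
  simp only [pairKernel, hp, Pi.smul_apply, smul_eq_mul, map_mul]
  ring

theorem pair_add_right (φ : L2 ℓ n) (q q' : Sector ℓ (n + 1)) :
    pair φ (q + q').fn = pair φ q.fn + pair φ q'.fn := by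
  unfold pair
  rw [← integral_add (integrable_pairKernel φ q) (integrable_pairKernel φ q')]
  refine integral_congr_ae ?_
  filter_upwards [ae_comp_snocMap (Lp.coeFn_add q.fn q'.fn)] with p hp
  simp only [pairKernel, Sector.fn_add, hp, Pi.add_apply]
  ring

theorem pair_smul_right (c : ℂ) (φ : L2 ℓ n) (ψ : L2 ℓ (n + 1)) :
    pair φ (c • ψ) = c * pair φ ψ := by
  unfold pair
  rw [← integral_const_mul]
  refine integral_congr_ae ?_
  filter_upwards [ae_comp_snocMap (Lp.coeFn_smul c ψ)] with p hp
  simp only [pairKernel, hp, Pi.smul_apply, smul_eq_mul]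
  ring

/-- The pairing `⟨p, a(v) q⟩` between the sectors with `n` and `n + 1` phonons. -/
def sectorPair (p : Sector ℓ n) (q : Sector ℓ (n + 1)) : ℂ :=
  (√((n : ℝ) + 1) : ℂ) * pair p.fn q.fn

theorem sqrt_mul_norm_fn_le (p : Sector ℓ n) : √((n : ℝ) + 1) * ‖p.fn‖ ≤ ‖p‖ := by
  refine le_of_sq_le_sq ?_ (norm_nonneg _)
  rw [Sector.norm_sq_eq, mul_pow, Real.sq_sqrt (by positivity)]
  have : 0 ≤ ∑ i, ‖p.gradient i‖ ^ 2 := by positivity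
  linarith

theorem sectorPair_bound {δ : ℝ} (hδ : 0 < δ) : ∃ b : ℝ, 0 ≤ b ∧
    ∀ (ℓ : ℝ) [Fact (0 < ℓ)] (n : ℕ) (p : Sector ℓ n) (q : Sector ℓ (n + 1)),
      ‖sectorPair p q‖ ≤ δ * (‖p‖ * ‖q‖) + b * (‖p.fn‖ * ‖q‖) := by
  obtain ⟨b, hb0, hb⟩ := pairKernel_bound hδ
  refine ⟨b, hb0, fun ℓ _ n p q => ?_⟩
  have hpair : ‖pair p.fn q.fn‖ ≤ ‖p.fn‖ * (δ * √(∑ i, ‖q.gradient i‖ ^ 2) + b * ‖q.fn‖) :=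
    (norm_integral_le_integral_norm _).trans
      (hb ℓ n p.fn q.fn q.gradient q.hasGenerator_fn).2
  have hgrad : √(∑ i, ‖q.gradient i‖ ^ 2) ≤ ‖q‖ := by
    refine Real.sqrt_le_iff.2 ⟨norm_nonneg _, ?_⟩
    rw [Sector.norm_sq_eq]
    have : 0 ≤ ((n + 1 : ℕ) : ℝ) * ‖q.fn‖ ^ 2 := by positivity
    linarith [sq_nonneg ‖q.fn‖]
  have hp := sqrt_mul_norm_fn_le p
  have hq : √((n : ℝ) + 1) * ‖q.fn‖ ≤ ‖q‖ := by
    refine le_trans ?_ (sqrt_mul_norm_fn_le q)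
    gcongr
    exact le_self_add
  rw [sectorPair, norm_mul, Complex.norm_real, Real.norm_of_nonneg (Real.sqrt_nonneg _)]
  calc √((n : ℝ) + 1) * ‖pair p.fn q.fn‖
      ≤ √((n : ℝ) + 1) * (‖p.fn‖ * (δ * √(∑ i, ‖q.gradient i‖ ^ 2) + b * ‖q.fn‖)) := by gcongr
    _ = δ * ((√((n : ℝ) + 1) * ‖p.fn‖) * √(∑ i, ‖q.gradient i‖ ^ 2))
        + b * (‖p.fn‖ * (√((n : ℝ) + 1) * ‖q.fn‖)) := by ring
    _ ≤ δ * (‖p‖ * ‖q‖) + b * (‖p.fn‖ * ‖q‖) := by gcongr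

theorem summable_succ_norm_sq (q : FormSpace ℓ) :
    Summable (fun n => ‖q (n + 1)‖ ^ 2) ∧ ∑' n, ‖q (n + 1)‖ ^ 2 ≤ ‖q‖ ^ 2 := by
  have hq := lp_two_hasSum_norm_sq q
  have hsplit := hq.summable.tsum_eq_zero_add
  rw [hq.tsum_eq] at hsplit
  exact ⟨(summable_nat_add_iff 1).2 hq.summable, by linarith [sq_nonneg ‖q 0‖]⟩

/-- The interaction form `⟨p, a(v) q⟩`. -/
def intForm (p q : FormSpace ℓ) : ℂ := ∑' n, sectorPair (p n) (q (n + 1))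

theorem intForm_bound {δ : ℝ} (hδ : 0 < δ) : ∃ b : ℝ, 0 ≤ b ∧
    ∀ (ℓ : ℝ) [Fact (0 < ℓ)] (p q : FormSpace ℓ),
      Summable (fun n => sectorPair (p n) (q (n + 1))) ∧
      ‖intForm p q‖ ≤ δ * (‖p‖ * ‖q‖) + b * (‖embed ℓ p‖ * ‖q‖) := by
  obtain ⟨b, hb0, hb⟩ := sectorPair_bound hδ
  refine ⟨b, hb0, fun ℓ _ p q => ?_⟩
  obtain ⟨hq, hq_le⟩ := summable_succ_norm_sq q
  have hp := lp_two_hasSum_norm_sq p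
  have hp' := hasSum_norm_comp_sq (embed ℓ p)
  obtain ⟨hform, hform_le⟩ := tsum_mul_le_of_sq (fun n => norm_nonneg (p n))
    (fun n => norm_nonneg (q (n + 1))) (norm_nonneg p) (norm_nonneg q) hp.summable hq
    hp.tsum_eq.le hq_le
  obtain ⟨hfn, hfn_le⟩ := tsum_mul_le_of_sq (fun n => norm_nonneg (comp (embed ℓ p) n))
    (fun n => norm_nonneg (q (n + 1))) (norm_nonneg _) (norm_nonneg q) hp'.summable hq
    hp'.tsum_eq.le hq_le
  have hbound := (hform.mul_left δ).add (hfn.mul_left b)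
  have hpair : Summable fun n => ‖sectorPair (p n) (q (n + 1))‖ :=
    .of_nonneg_of_le (fun n => norm_nonneg _) (fun n => hb ℓ n (p n) (q (n + 1))) hbound
  refine ⟨hpair.of_norm, (norm_tsum_le_tsum_norm hpair).trans
    ((hpair.tsum_le_tsum (fun n => hb ℓ n (p n) (q (n + 1))) hbound).trans ?_)⟩
  have hsum := (hform.mul_left δ).tsum_add (hfn.mul_left b)
  simp only [comp_embed] at hfn_le hsum
  rw [hsum, tsum_mul_left, tsum_mul_left]
  gcongr

theorem summable_sectorPair (p q : FormSpace ℓ) :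
    Summable (fun n => sectorPair (p n) (q (n + 1))) := by
  obtain ⟨b, -, hb⟩ := intForm_bound one_pos
  exact (hb ℓ p q).1

theorem intForm_add_left (p p' q : FormSpace ℓ) :
    intForm (p + p') q = intForm p q + intForm p' q := by
  have hpair : ∀ n, sectorPair ((p + p') n) (q (n + 1))
      = sectorPair (p n) (q (n + 1)) + sectorPair (p' n) (q (n + 1)) := fun n => by
    rw [lp.coeFn_add, Pi.add_apply, sectorPair, Sector.fn_add, pair_add_left, mul_add]
    rfl
  unfold intForm
  rw [← (summable_sectorPair p q).tsum_add (summable_sectorPair p' q)]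
  exact tsum_congr hpair

theorem intForm_smul_left (c : ℂ) (p q : FormSpace ℓ) :
    intForm (c • p) q = starRingEnd ℂ c * intForm p q := by
  have hpair : ∀ n, sectorPair ((c • p) n) (q (n + 1))
      = starRingEnd ℂ c * sectorPair (p n) (q (n + 1)) := fun n => by
    rw [lp.coeFn_smul, Pi.smul_apply, sectorPair, Sector.fn_smul, pair_smul_left, mul_left_comm]
    rfl
  unfold intForm
  rw [← tsum_mul_left]
  exact tsum_congr hpair

theorem intForm_add_right (p q q' : FormSpace ℓ) :
    intForm p (q + q') = intForm p q + intForm p q' := by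
  have hpair : ∀ n, sectorPair (p n) ((q + q') (n + 1))
      = sectorPair (p n) (q (n + 1)) + sectorPair (p n) (q' (n + 1)) := fun n => by
    rw [lp.coeFn_add, Pi.add_apply, sectorPair, pair_add_right, mul_add]
    rfl
  unfold intForm
  rw [← (summable_sectorPair p q).tsum_add (summable_sectorPair p q')]
  exact tsum_congr hpair

theorem intForm_smul_right (c : ℂ) (p q : FormSpace ℓ) :
    intForm p (c • q) = c * intForm p q := by
  have hpair : ∀ n, sectorPair (p n) ((c • q) (n + 1)) = c * sectorPair (p n) (q (n + 1)) := by
    intro n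
    rw [lp.coeFn_smul, Pi.smul_apply, sectorPair, Sector.fn_smul, pair_smul_right, mul_left_comm]
    rfl
  unfold intForm
  rw [← tsum_mul_left]
  exact tsum_congr hpair

theorem exists_norm_intForm_le : ∃ C : ℝ, ∀ (ℓ : ℝ) [Fact (0 < ℓ)] (p q : FormSpace ℓ),
    ‖intForm p q‖ ≤ C * ‖p‖ * ‖q‖ := by
  obtain ⟨b, hb0, hb⟩ := intForm_bound one_pos
  refine ⟨1 + b, fun ℓ _ p q => (hb ℓ p q).2.trans ?_⟩
  have hembed := mul_le_mul_of_nonneg_left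
    (mul_le_mul_of_nonneg_right (norm_embed_le p) (norm_nonneg q)) hb0
  linarith

/-- The interaction form as a sesquilinear map. -/
def intSesq (ℓ : ℝ) [Fact (0 < ℓ)] : FormSpace ℓ →ₗ⋆[ℂ] FormSpace ℓ →ₗ[ℂ] ℂ :=
  LinearMap.mk₂'ₛₗ (starRingEnd ℂ) (RingHom.id ℂ) intForm intForm_add_left intForm_smul_left
    intForm_add_right intForm_smul_right

/-- The interaction form as a bounded sesquilinear form. -/
def intBilin (ℓ : ℝ) [Fact (0 < ℓ)] : FormSpace ℓ →L⋆[ℂ] FormSpace ℓ →L[ℂ] ℂ :=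
  LinearMap.mkContinuous₂ (intSesq ℓ) exists_norm_intForm_le.choose
    (exists_norm_intForm_le.choose_spec ℓ)

/-- The bounded operator on the form space that represents the interaction form. -/
def intOp (ℓ : ℝ) [Fact (0 < ℓ)] : FormSpace ℓ →L[ℂ] FormSpace ℓ :=
  InnerProductSpace.continuousLinearMapOfBilin (intBilin ℓ)

theorem inner_intOp_left (p q : FormSpace ℓ) : ⟪intOp ℓ p, q⟫_ℂ = intForm p q :=
  InnerProductSpace.continuousLinearMapOfBilin_apply (intBilin ℓ) p q

theorem inner_intOp_right (p q : FormSpace ℓ) :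
    ⟪p, intOp ℓ q⟫_ℂ = starRingEnd ℂ (intForm q p) := by
  rw [← inner_intOp_left, inner_conj_symm]

/-- The bounded operator on the form space that represents the form of `h_ℓ + lam`. -/
def formOp (ℓ : ℝ) [Fact (0 < ℓ)] (α lam : ℝ) : FormSpace ℓ →L[ℂ] FormSpace ℓ :=
  1 + ((lam - 1 : ℝ) : ℂ) • ((embed ℓ).adjoint ∘L embed ℓ)
    + (√α : ℂ) • ((intOp ℓ).adjoint + intOp ℓ)

theorem inner_formOp (α lam : ℝ) (p q : FormSpace ℓ) : ⟪p, formOp ℓ α lam q⟫_ℂ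
    = ⟪p, q⟫_ℂ + ((lam - 1 : ℝ) : ℂ) * ⟪embed ℓ p, embed ℓ q⟫_ℂ
      + (√α : ℂ) * (intForm p q + starRingEnd ℂ (intForm q p)) := by
  simp only [formOp, add_apply, smul_apply, one_apply_eq_self, ContinuousLinearMap.comp_apply,
    inner_add_right, inner_smul_right, ContinuousLinearMap.adjoint_inner_right, inner_intOp_left,
    inner_intOp_right]

theorem formOp_symm (α lam : ℝ) (p q : FormSpace ℓ) :
    ⟪formOp ℓ α lam p, q⟫_ℂ = ⟪p, formOp ℓ α lam q⟫_ℂ := by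
  rw [← inner_conj_symm, inner_formOp, inner_formOp]
  simp only [map_add, map_mul, Complex.conj_ofReal, inner_conj_symm, Complex.conj_conj]
  ring

theorem integral_annihilate_right (p q : FormSpace ℓ) (n : ℕ) :
    ∫ z, starRingEnd ℂ (comp (embed ℓ p) n z) * annihilate (embed ℓ q) n z
      = sectorPair (p n) (q (n + 1)) := by
  have hfubini := integral_prod (μ := (volume : Measure (Conf ℓ n))) (ν := (volume : Measure R3)) _
    (integrable_pairKernel (p n).fn (q (n + 1)))
  rw [sectorPair, pair]
  refine Eq.trans ?_ (congrArg _ hfubini.symm)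
  rw [← integral_const_mul]
  refine integral_congr_ae (Eventually.of_forall fun z => ?_)
  simp only [annihilate, pairKernel, comp_embed]
  rw [integral_const_mul]
  simp only [snocMap]
  ring

theorem integral_annihilate_left (p q : FormSpace ℓ) (n : ℕ) :
    ∫ z, starRingEnd ℂ (annihilate (embed ℓ p) n z) * comp (embed ℓ q) n z
      = starRingEnd ℂ (sectorPair (q n) (p (n + 1))) := by
  rw [← integral_annihilate_right, ← integral_conj]
  refine integral_congr_ae (Eventually.of_forall fun z => ?_)
  simp only [map_mul, Complex.conj_conj]
  ring

theorem form_embed (α lam : ℝ) (p q : FormSpace ℓ) :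
    form α (embed ℓ p) (embed ℓ q) + (lam : ℂ) * ⟪embed ℓ p, embed ℓ q⟫_ℂ
      = ⟪p, formOp ℓ α lam q⟫_ℂ := by
  have hfree := (lp.hasSum_inner (𝕜 := ℂ) p q).sub (hasSum_inner_comp (embed ℓ p) (embed ℓ q))
  have hinteg := ((summable_sectorPair p q).hasSum.add ((summable_sectorPair q p).hasSum.map
    (starRingEnd ℂ : ℂ →+* ℂ) Complex.continuous_conj)).mul_left (√α : ℂ)
  have hform : form α (embed ℓ p) (embed ℓ q) = ⟪p, q⟫_ℂ - ⟪embed ℓ p, embed ℓ q⟫_ℂ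
      + (√α : ℂ) * (intForm p q + starRingEnd ℂ (intForm q p)) := by
    refine Eq.trans (tsum_congr fun n => ?_) (hfree.add hinteg).tsum_eq
    rw [integral_annihilate_right, integral_annihilate_left, Sector.inner_eq]
    simp only [comp_embed, Sector.gradient_eq_grad, Function.comp_apply]
    ring
  rw [hform, inner_formOp]
  push_cast
  ring

theorem re_inner_formOp_self (α lam : ℝ) (p : FormSpace ℓ) : (⟪p, formOp ℓ α lam p⟫_ℂ).re
    = ‖p‖ ^ 2 + (lam - 1) * ‖embed ℓ p‖ ^ 2 + √α * (2 * (intForm p p).re) := by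
  rw [inner_formOp, inner_self_eq_norm_sq_to_K, inner_self_eq_norm_sq_to_K, Complex.add_conj]
  simp only [Complex.coe_algebraMap, Complex.add_re, Complex.re_ofReal_mul,
    ← Complex.ofReal_pow, Complex.ofReal_re]

theorem exists_isCoerciveOperator_formOp (α : ℝ) : ∃ lam₀ : ℝ, 0 < lam₀ ∧
    ∀ (ℓ : ℝ) [Fact (0 < ℓ)] (lam : ℝ), lam₀ ≤ lam → IsCoerciveOperator (formOp ℓ α lam) := by
  set s := √α
  have hs : 0 ≤ s := Real.sqrt_nonneg _
  obtain ⟨b, -, hb⟩ := intForm_bound (δ := 1 / (8 * (s + 1))) (by positivity)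
  refine ⟨1 + 4 * (s * b) ^ 2, by positivity, fun ℓ _ lam hlam => ⟨1 / 2, by norm_num, fun p => ?_⟩⟩
  have hsmall : s * (1 / (8 * (s + 1))) ≤ 1 / 8 := by
    rw [mul_one_div, div_le_div_iff₀ (by positivity) (by norm_num)]
    linarith
  have hinteg : s * |(intForm p p).re| ≤ 1 / 8 * ‖p‖ ^ 2 + s * b * (‖embed ℓ p‖ * ‖p‖) :=
    calc s * |(intForm p p).re|
        ≤ s * (1 / (8 * (s + 1)) * (‖p‖ * ‖p‖) + b * (‖embed ℓ p‖ * ‖p‖)) := by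
          gcongr
          exact (Complex.abs_re_le_norm _).trans (hb ℓ p p).2
      _ = s * (1 / (8 * (s + 1))) * ‖p‖ ^ 2 + s * b * (‖embed ℓ p‖ * ‖p‖) := by ring
      _ ≤ _ := by gcongr
  have hneg : -(s * |(intForm p p).re|) ≤ s * (intForm p p).re := by
    rw [← mul_neg]
    exact mul_le_mul_of_nonneg_left (neg_abs_le _) hs
  have hlarge : 4 * (s * b) ^ 2 * ‖embed ℓ p‖ ^ 2 ≤ (lam - 1) * ‖embed ℓ p‖ ^ 2 := by
    gcongr
    linarith
  rw [re_inner_formOp_self]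
  nlinarith [sq_nonneg (2 * (s * b) * ‖embed ℓ p‖ - 1 / 2 * ‖p‖)]

end Interaction

section Cone

variable {ℓ : ℝ} [Fact (0 < ℓ)] {n : ℕ}

theorem neg_one_pow_mul_self (n : ℕ) : ((-1 : ℂ) ^ n) * (-1) ^ n = 1 := by
  rw [← mul_pow, neg_one_mul, neg_neg, one_pow]

/-- The function `(-1)ⁿ |f|`, which is the modulus of `f` with respect to the cone. -/
def signedAbs (f : L2 ℓ n) : L2 ℓ n := ((-1 : ℂ) ^ n) • absLp f

theorem coeFn_signedAbs (f : L2 ℓ n) :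
    ∀ᵐ z, signedAbs f z = (-1) ^ n * ((‖f z‖ : ℝ) : ℂ) := by
  filter_upwards [Lp.coeFn_smul ((-1 : ℂ) ^ n) (absLp f), coeFn_absLp f] with z hsmul habs
  rw [signedAbs, hsmul, Pi.smul_apply, habs, smul_eq_mul]

theorem norm_neg_one_pow_smul (f : L2 ℓ n) : ‖((-1 : ℂ) ^ n) • f‖ = ‖f‖ := by
  rw [norm_smul, norm_pow, norm_neg, norm_one, one_pow, one_mul]

theorem norm_signedAbs (f : L2 ℓ n) : ‖signedAbs f‖ = ‖f‖ :=
  (norm_neg_one_pow_smul _).trans (norm_absLp f)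

theorem ae_nonneg_iff_signedAbs_eq (f : L2 ℓ n) :
    (∀ᵐ z, (0 : ℂ) ≤ (-1) ^ n * f z) ↔ signedAbs f = f := by
  constructor
  · intro hf
    refine Lp.ext ?_
    filter_upwards [hf, coeFn_signedAbs f] with z hz habs
    have hnorm := Complex.eq_coe_norm_of_nonneg hz
    rw [norm_mul, norm_pow, norm_neg, norm_one, one_pow, one_mul] at hnorm
    rw [habs, ← hnorm, ← mul_assoc, neg_one_pow_mul_self, one_mul]
  · intro hf
    filter_upwards [coeFn_signedAbs f] with z habs
    rw [hf] at habs
    rw [habs, ← mul_assoc, neg_one_pow_mul_self, one_mul]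
    exact_mod_cast norm_nonneg _

theorem mem_cone_iff {Ψ : Hilb ℓ} : Ψ ∈ cone ℓ ↔ ∀ n, signedAbs (comp Ψ n) = comp Ψ n :=
  forall_congr' fun n => ae_nonneg_iff_signedAbs_eq (comp Ψ n)

theorem ae_eq_of_mem_cone {Ψ : Hilb ℓ} (hΨ : Ψ ∈ cone ℓ) (n : ℕ) :
    ∀ᵐ z, comp Ψ n z = (-1) ^ n * ((‖comp Ψ n z‖ : ℝ) : ℂ) := by
  have h := coeFn_signedAbs (comp Ψ n)
  rwa [mem_cone_iff.1 hΨ n] at h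

theorem inner_comp_of_mem_cone {Φ Ψ : Hilb ℓ} (hΦ : Φ ∈ cone ℓ) (hΨ : Ψ ∈ cone ℓ) (n : ℕ) :
    ⟪comp Φ n, comp Ψ n⟫_ℂ = ((∫ z, ‖comp Φ n z‖ * ‖comp Ψ n z‖ : ℝ) : ℂ) := by
  rw [L2.inner_def, ← integral_complex_ofReal]
  refine integral_congr_ae ?_
  filter_upwards [ae_eq_of_mem_cone hΦ n, ae_eq_of_mem_cone hΨ n] with z hΦz hΨz
  rw [RCLike.inner_apply]
  conv_lhs => rw [hΦz, hΨz]
  rw [map_mul, map_pow, map_neg, map_one, Complex.conj_ofReal, mul_mul_mul_comm,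
    neg_one_pow_mul_self, one_mul, mul_comm, Complex.ofReal_mul]

theorem hasSum_inner_of_mem_cone {Φ Ψ : Hilb ℓ} (hΦ : Φ ∈ cone ℓ) (hΨ : Ψ ∈ cone ℓ) :
    HasSum (fun n => ∫ z, ‖comp Φ n z‖ * ‖comp Ψ n z‖) (⟪Φ, Ψ⟫_ℂ).re := by
  simpa only [inner_comp_of_mem_cone hΦ hΨ, Complex.reCLM_apply, Complex.ofReal_re]
    using Complex.reCLM.hasSum (hasSum_inner_comp Φ Ψ)

theorem inner_nonneg_of_mem_cone {Φ Ψ : Hilb ℓ} (hΦ : Φ ∈ cone ℓ) (hΨ : Ψ ∈ cone ℓ) :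
    0 ≤ ⟪Φ, Ψ⟫_ℂ := by
  refine (hasSum_inner_comp Φ Ψ).nonneg fun n => ?_
  rw [inner_comp_of_mem_cone hΦ hΨ, Complex.zero_le_real]
  exact integral_nonneg fun z => by positivity

theorem ae_norm_mul_norm_eq_zero {Φ Ψ : Hilb ℓ} (hΦ : Φ ∈ cone ℓ) (hΨ : Ψ ∈ cone ℓ)
    (h : ⟪Φ, Ψ⟫_ℂ = 0) (n : ℕ) : ∀ᵐ z, ‖comp Φ n z‖ * ‖comp Ψ n z‖ = 0 := by
  have hsum := hasSum_inner_of_mem_cone hΦ hΨ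
  rw [h, Complex.zero_re, hasSum_zero_iff_of_nonneg
    fun n => integral_nonneg fun z => by positivity] at hsum
  have hinteg : Integrable (fun z => ‖comp Φ n z‖ * ‖comp Ψ n z‖) volume :=
    (Lp.memLp (comp Φ n)).norm.integrable_mul (Lp.memLp (comp Ψ n)).norm
  exact (integral_eq_zero_iff_of_nonneg (fun z => by positivity) hinteg).1 (congrFun hsum n)

theorem pairKernel_of_mem_cone {p q : FormSpace ℓ} (hp : embed ℓ p ∈ cone ℓ)
    (hq : embed ℓ q ∈ cone ℓ) (n : ℕ) : ∀ᵐ x, pairKernel (p n).fn (q (n + 1)).fn x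
      = -((‖pairKernel (p n).fn (q (n + 1)).fn x‖ : ℝ) : ℂ) := by
  filter_upwards [ae_comp_fst (ae_eq_of_mem_cone hp n),
    ae_comp_snocMap (ae_eq_of_mem_cone hq (n + 1))] with x hpx hqx
  simp only [comp_embed] at hpx hqx
  simp only [pairKernel, norm_mul, RCLike.norm_conj, Complex.norm_real, Real.norm_eq_abs,
    abs_of_nonneg (v_nonneg _)]
  conv_lhs => rw [hpx, hqx]
  rw [map_mul, map_pow, map_neg, map_one, Complex.conj_ofReal, pow_succ]
  push_cast
  linear_combination -(((‖(p n).fn x.1‖ : ℝ) : ℂ) * (v x.2 : ℂ) *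
    ((‖(q (n + 1)).fn (snocMap x)‖ : ℝ) : ℂ)) * neg_one_pow_mul_self n

theorem sectorPair_of_mem_cone {p q : FormSpace ℓ} (hp : embed ℓ p ∈ cone ℓ)
    (hq : embed ℓ q ∈ cone ℓ) (n : ℕ) : sectorPair (p n) (q (n + 1))
      = ((-(√((n : ℝ) + 1) * ∫ x, ‖pairKernel (p n).fn (q (n + 1)).fn x‖) : ℝ) : ℂ) := by
  rw [sectorPair, pair, integral_congr_ae (pairKernel_of_mem_cone hp hq n), integral_neg,
    integral_complex_ofReal]
  push_cast
  ring

theorem hasSum_intForm_of_mem_cone {p q : FormSpace ℓ} (hp : embed ℓ p ∈ cone ℓ)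
    (hq : embed ℓ q ∈ cone ℓ) : HasSum (fun n : ℕ =>
      √((n : ℝ) + 1) * ∫ x, ‖pairKernel (p n).fn (q (n + 1)).fn x‖) (-intForm p q).re := by
  have hsum : HasSum (fun n => -(sectorPair (p n) (q (n + 1))).re) (-intForm p q).re :=
    (Complex.reCLM.hasSum (summable_sectorPair p q).hasSum).neg
  simpa only [sectorPair_of_mem_cone hp hq, Complex.ofReal_re, neg_neg] using hsum

theorem intForm_nonpos_of_mem_cone {p q : FormSpace ℓ} (hp : embed ℓ p ∈ cone ℓ)
    (hq : embed ℓ q ∈ cone ℓ) : intForm p q ≤ 0 := by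
  refine (summable_sectorPair p q).hasSum.nonpos fun n => ?_
  rw [sectorPair_of_mem_cone hp hq]
  exact_mod_cast neg_nonpos.2 (by positivity)

end Cone

section Preserving

variable {ℓ : ℝ} [Fact (0 < ℓ)] {n : ℕ}

theorem exists_sector_signedAbs (p : Sector ℓ n) :
    ∃ q : Sector ℓ n, q.fn = signedAbs p.fn ∧ ‖q‖ ≤ ‖p‖ := by
  choose g hg hg_le using fun i => exists_hasGenerator_absLp (p.hasGenerator_fn i)
  let q := Sector.mk (signedAbs p.fn)
    (Submodule.smul_mem _ _ (absLp_mem_nPhonon p.fn_mem)) (fun i => ((-1 : ℂ) ^ n) • g i)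
    (fun i => hasGenerator_smul _ (hg i))
  have hfn : ‖q.fn‖ = ‖p.fn‖ := norm_signedAbs _
  have hgrad : ∀ i, ‖q.gradient i‖ ≤ ‖p.gradient i‖ := fun i =>
    (norm_neg_one_pow_smul (g i)).trans_le (hg_le i)
  refine ⟨q, rfl, le_of_sq_le_sq ?_ (norm_nonneg _)⟩
  rw [Sector.norm_sq_eq, Sector.norm_sq_eq, hfn]
  gcongr with i _
  exact hgrad i

theorem exists_lp_two_of_norm_le {G : ℕ → Type*} [∀ n, NormedAddCommGroup (G n)] (p : lp G 2)
    (q : ∀ n, G n) (h : ∀ n, ‖q n‖ ≤ ‖p n‖) : ∃ r : lp G 2, (∀ n, r n = q n) ∧ ‖r‖ ≤ ‖p‖ := by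
  have hp := lp_two_hasSum_norm_sq p
  have hle : ∀ n, ‖q n‖ ^ 2 ≤ ‖p n‖ ^ 2 := fun n => pow_le_pow_left₀ (norm_nonneg _) (h n) 2
  have hsum := hp.summable.of_nonneg_of_le (fun n => sq_nonneg _) hle
  let r : lp G 2 := ⟨q, memℓp_two_of_summable hsum⟩
  exact ⟨r, fun n => rfl,
    le_of_sq_le_sq (hasSum_le hle (lp_two_hasSum_norm_sq r) hp) (norm_nonneg _)⟩

theorem exists_signedAbs (p : FormSpace ℓ) : ∃ q : FormSpace ℓ,
    (∀ n, (q n).fn = signedAbs (p n).fn) ∧ ‖q‖ ≤ ‖p‖ := by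
  choose q hq hq_le using fun n => exists_sector_signedAbs (p n)
  obtain ⟨r, hr, hr_le⟩ := exists_lp_two_of_norm_le p q hq_le
  exact ⟨r, fun n => (congrArg Sector.fn (hr n)).trans (hq n), hr_le⟩

theorem embed_mem_cone_of_signedAbs {p q : FormSpace ℓ}
    (h : ∀ n, (q n).fn = signedAbs (p n).fn) : embed ℓ q ∈ cone ℓ := by
  intro n
  rw [comp_embed, h n]
  filter_upwards [coeFn_signedAbs (p n).fn] with z hz
  rw [hz, ← mul_assoc, neg_one_pow_mul_self, one_mul]
  exact_mod_cast norm_nonneg _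

theorem re_intForm_le_of_signedAbs {p q : FormSpace ℓ}
    (h : ∀ n, (q n).fn = signedAbs (p n).fn) : (intForm q q).re ≤ (intForm p p).re := by
  have hq := embed_mem_cone_of_signedAbs h
  refine hasSum_le (fun n => ?_) (Complex.reCLM.hasSum (summable_sectorPair q q).hasSum)
    (Complex.reCLM.hasSum (summable_sectorPair p p).hasSum)
  have hkernel : ∫ x, ‖pairKernel (q n).fn (q (n + 1)).fn x‖
      = ∫ x, ‖pairKernel (p n).fn (p (n + 1)).fn x‖ := by
    refine integral_congr_ae ?_
    filter_upwards [ae_comp_fst (coeFn_signedAbs (p n).fn),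
      ae_comp_snocMap (coeFn_signedAbs (p (n + 1)).fn)] with x hx hx'
    rw [← h n] at hx
    rw [← h (n + 1)] at hx'
    simp [pairKernel, hx, hx']
  have hpair : ‖pair (p n).fn (p (n + 1)).fn‖ ≤ ∫ x, ‖pairKernel (p n).fn (p (n + 1)).fn x‖ :=
    norm_integral_le_integral_norm _
  simp only [Complex.reCLM_apply]
  rw [sectorPair_of_mem_cone hq hq, Complex.ofReal_re, sectorPair, Complex.re_ofReal_mul,
    ← mul_neg, hkernel]
  refine mul_le_mul_of_nonneg_left ?_ (Real.sqrt_nonneg _)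
  exact neg_le_of_abs_le ((Complex.abs_re_le_norm _).trans hpair)

theorem re_inner_le_of_signedAbs {p q : FormSpace ℓ}
    (h : ∀ n, (q n).fn = signedAbs (p n).fn) {f : Hilb ℓ} (hf : f ∈ cone ℓ) :
    (⟪embed ℓ p, f⟫_ℂ).re ≤ (⟪embed ℓ q, f⟫_ℂ).re := by
  refine hasSum_le (fun n => ?_) (Complex.reCLM.hasSum (hasSum_inner_comp (embed ℓ p) f))
    (hasSum_inner_of_mem_cone (embed_mem_cone_of_signedAbs h) hf)
  have hnorm : ∫ z, ‖comp (embed ℓ q) n z‖ * ‖comp f n z‖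
      = ∫ z, ‖comp (embed ℓ p) n z‖ * ‖comp f n z‖ := by
    refine integral_congr_ae ?_
    filter_upwards [coeFn_signedAbs (p n).fn] with z hz
    rw [← h n] at hz
    simp [comp_embed, hz]
  rw [hnorm, Complex.reCLM_apply, L2.inner_def]
  refine (Complex.re_le_norm _).trans ((norm_integral_le_integral_norm _).trans_eq ?_)
  exact integral_congr_ae (Eventually.of_forall fun z => by simp [mul_comm])

/-- `p` is the weak solution of `(h_ℓ + lam) p = f`. -/
abbrev IsSolution (α lam : ℝ) (p : FormSpace ℓ) (f : Hilb ℓ) : Prop :=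
  IsWeakSolution (embed ℓ) (formOp ℓ α lam) p f

theorem norm_embed_eq_of_signedAbs {p q : FormSpace ℓ}
    (h : ∀ n, (q n).fn = signedAbs (p n).fn) : ‖embed ℓ q‖ ^ 2 = ‖embed ℓ p‖ ^ 2 := by
  have hq := hasSum_norm_comp_sq (embed ℓ q)
  simp only [comp_embed, h, norm_signedAbs] at hq
  exact hq.unique (hasSum_norm_comp_sq (embed ℓ p))

theorem IsSolution.embed_mem_cone {α lam : ℝ} (hS : IsCoerciveOperator (formOp ℓ α lam))
    {f : Hilb ℓ} (hf : f ∈ cone ℓ) {p : FormSpace ℓ} (hp : IsSolution α lam p f) :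
    embed ℓ p ∈ cone ℓ := by
  obtain ⟨q, hq, hq_le⟩ := exists_signedAbs p
  have hquad : (⟪q, formOp ℓ α lam q⟫_ℂ).re ≤ (⟪p, formOp ℓ α lam p⟫_ℂ).re := by
    rw [re_inner_formOp_self, re_inner_formOp_self, norm_embed_eq_of_signedAbs hq]
    have := re_intForm_le_of_signedAbs hq
    gcongr
  rw [← hp.eq_of_energy_le hS (formOp_symm α lam) hquad (re_inner_le_of_signedAbs hq hf)]
  exact embed_mem_cone_of_signedAbs hq

end Preserving

section Resolvent

variable {ℓ : ℝ} [Fact (0 < ℓ)] {α lam : ℝ} {R : Hilb ℓ →L[ℂ] Hilb ℓ}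

theorem isSolution_iff_form_eq {p : FormSpace ℓ} {f : Hilb ℓ} : IsSolution α lam p f ↔
    ∀ q, form α (embed ℓ q) (embed ℓ p) = ⟪embed ℓ q, -(lam : ℂ) • embed ℓ p + f⟫_ℂ := by
  refine forall_congr' fun q => ?_
  rw [← form_embed, inner_add_right, inner_smul_right, ← sub_eq_iff_eq_add', neg_mul,
    sub_neg_eq_add]

/-- `R` maps each `f` to the weak solution of `(h_ℓ + lam) p = f`. -/
def IsSolutionOperator (α lam : ℝ) (R : Hilb ℓ →L[ℂ] Hilb ℓ) : Prop :=
  ∀ f, ∃ p, R f = embed ℓ p ∧ IsSolution α lam p f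

theorem IsSolutionOperator.apply_eq (hR : IsSolutionOperator α lam R)
    (hS : IsCoerciveOperator (formOp ℓ α lam)) {p : FormSpace ℓ} {f : Hilb ℓ}
    (hp : IsSolution α lam p f) : R f = embed ℓ p := by
  obtain ⟨q, hRf, hq⟩ := hR f
  rw [hRf, hq.unique hS hp]

theorem IsSolutionOperator.isResolvent (hR : IsSolutionOperator α lam R)
    (hS : IsCoerciveOperator (formOp ℓ α lam)) : IsResolvent (hGraph α ℓ) (-(lam : ℂ)) R := by
  refine fun f Ψ => ⟨?_, ?_⟩
  · rintro rfl
    obtain ⟨p, hRf, hp⟩ := hR f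
    refine ⟨(mem_FormDomain_iff _).2 ⟨p, hRf.symm⟩, fun Φ hΦ => ?_⟩
    obtain ⟨q, rfl⟩ := (mem_FormDomain_iff _).1 hΦ
    rw [hRf]
    exact isSolution_iff_form_eq.1 hp q
  · rintro ⟨hdom, hform⟩
    obtain ⟨p, rfl⟩ := (mem_FormDomain_iff _).1 hdom
    exact hR.apply_eq hS (isSolution_iff_form_eq.2 fun q =>
      hform (embed ℓ q) ((mem_FormDomain_iff _).2 ⟨q, rfl⟩))

theorem IsSolutionOperator.mem_cone (hR : IsSolutionOperator α lam R)
    (hS : IsCoerciveOperator (formOp ℓ α lam)) {f : Hilb ℓ} (hf : f ∈ cone ℓ) :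
    R f ∈ cone ℓ := by
  obtain ⟨p, hRf, hp⟩ := hR f
  rw [hRf]
  exact hp.embed_mem_cone hS hf

end Resolvent

section Weight

theorem integrable_exp_neg_mul_norm {E : Type*} [NormedAddCommGroup E] [NormedSpace ℝ E]
    [FiniteDimensional ℝ E] [Nontrivial E] [MeasurableSpace E] [BorelSpace E] (μ : Measure E)
    [μ.IsAddHaarMeasure] {b : ℝ} (hb : 0 < b) : Integrable (fun y => Real.exp (-b * ‖y‖)) μ := by
  rw [integrable_fun_norm_addHaar μ (f := fun r => Real.exp (-b * r))]
  have h := integrableOn_rpow_mul_exp_neg_mul_rpow (p := 1) (b := b)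
    (s := (Module.finrank ℝ E - 1 : ℕ)) (neg_one_lt_zero.trans_le (Nat.cast_nonneg _)) one_pos hb
  simpa only [Real.rpow_natCast, Real.rpow_one, smul_eq_mul] using h

variable {ℓ : ℝ} {n : ℕ}

/-- A strictly positive symmetric function of the phonon positions, in the domain of the
gradient. -/
def weight (z : Conf ℓ n) : ℝ := Real.exp (-∑ j, ‖z.2 j‖)

theorem weight_pos (z : Conf ℓ n) : 0 < weight z := Real.exp_pos _

theorem continuous_weight : Continuous (weight : Conf ℓ n → ℝ) := by
  unfold weight
  fun_prop

theorem weight_permMap (σ : Equiv.Perm (Fin n)) (z : Conf ℓ n) :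
    weight (permMap ℓ n σ z) = weight z := by
  rw [weight, weight, permMap, Equiv.sum_comp σ fun j => ‖z.2 j‖]

theorem norm_weight (z : Conf ℓ n) : ‖(weight z : ℂ)‖ = weight z := by
  rw [Complex.norm_real, Real.norm_of_nonneg (weight_pos z).le]

theorem abs_weight_shift_sub_le (i : Fin 3) {t : ℝ} (ht : 0 < t) (hnt : n * t ≤ 1)
    (z : Conf ℓ n) : |weight (shiftMap ℓ n i t z) - weight z| ≤ 2 * (n * t) * weight z := by
  set a := ∑ j, ‖z.2 j‖
  set b := ∑ j, ‖(shiftMap ℓ n i t z).2 j‖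
  have hterm : ∀ j ∈ Finset.univ, |‖z.2 j‖ - ‖(shiftMap ℓ n i t z).2 j‖| ≤ t := fun j _ => by
    refine (abs_norm_sub_norm_le _ _).trans ?_
    simp [shiftMap, displacement, abs_of_pos ht]
  have hab : |a - b| ≤ n * t := by
    rw [← Finset.sum_sub_distrib]
    exact (Finset.abs_sum_le_sum_abs _ _).trans ((Finset.sum_le_sum hterm).trans_eq (by simp))
  have hdiff : weight (shiftMap ℓ n i t z) - weight z = (Real.exp (a - b) - 1) * weight z := by
    change Real.exp (-b) - Real.exp (-a) = (Real.exp (a - b) - 1) * Real.exp (-a)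
    rw [sub_one_mul, ← Real.exp_add, sub_add_eq_add_sub, add_neg_cancel, zero_sub]
  rw [hdiff, abs_mul, abs_of_pos (weight_pos z)]
  refine mul_le_mul_of_nonneg_right ?_ (weight_pos z).le
  exact (Real.abs_exp_sub_one_le (hab.trans hnt)).trans (by gcongr)

variable [Fact (0 < ℓ)]

theorem memLp_weight : MemLp (fun z : Conf ℓ n => (weight z : ℂ)) 2 volume := by
  have hmeas : AEStronglyMeasurable (fun z : Conf ℓ n => (weight z : ℂ)) volume :=
    (Complex.continuous_ofReal.comp continuous_weight).aestronglyMeasurable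
  rw [memLp_two_iff_integrable_sq_norm hmeas]
  have hphonons : Integrable (fun y : Fin n → R3 => ∏ j, Real.exp (-2 * ‖y j‖)) volume :=
    Integrable.fintype_prod (f := fun _ (y : R3) => Real.exp (-2 * ‖y‖))
      fun _ => integrable_exp_neg_mul_norm volume two_pos
  have htorus : Integrable (fun _ : Torus ℓ => (1 : ℝ)) volume := integrable_const _
  refine (htorus.mul_prod hphonons).congr (Eventually.of_forall fun z => ?_)
  simp only [norm_weight, one_mul]
  rw [weight, ← Real.exp_nat_mul, ← Real.exp_sum, ← Finset.mul_sum, Nat.cast_ofNat, neg_mul,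
    mul_neg]

/-- The class of `weight` in `L²`. -/
def weightL2 (ℓ : ℝ) [Fact (0 < ℓ)] (n : ℕ) : L2 ℓ n := memLp_weight.toLp _

theorem coeFn_weightL2 : weightL2 ℓ n =ᵐ[volume] fun z => (weight z : ℂ) :=
  memLp_weight.coeFn_toLp

theorem weightL2_mem_nPhonon : weightL2 ℓ n ∈ nPhonon ℓ n := by
  refine mem_nPhonon_iff_ae.2 fun σ => ?_
  filter_upwards [coeFn_weightL2 (ℓ := ℓ) (n := n), (permMap_preserving ℓ n σ)
    |>.quasiMeasurePreserving.ae (coeFn_weightL2 (ℓ := ℓ) (n := n))] with z hz hσz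
  rw [hz, hσz, weight_permMap]

theorem exists_hasGenerator_weightL2 (i : Fin 3) :
    ∃ g, (shiftGroup i).HasGenerator (weightL2 ℓ n) g ∧ ‖g‖ ≤ 2 * n * ‖weightL2 ℓ n‖ := by
  refine IsometryGroup.exists_hasGenerator_of_lipschitz ?_
  have hsmall : ∀ᶠ t in 𝓝[>] (0 : ℝ), (n : ℝ) * t ≤ 1 := by
    have h : Tendsto (fun t : ℝ => (n : ℝ) * t) (𝓝 0) (𝓝 ((n : ℝ) * 0)) :=
      tendsto_const_nhds.mul tendsto_id
    rw [mul_zero] at h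
    exact nhdsWithin_le_nhds (h.eventually_le_const one_pos)
  filter_upwards [hsmall, self_mem_nhdsWithin] with t hnt ht
  have hle : ‖shiftGroup i t (weightL2 ℓ n) - weightL2 ℓ n‖
      ≤ (2 * (n * t)) * ‖weightL2 ℓ n‖ := by
    refine Lp.norm_le_mul_norm_of_ae_le_mul ?_
    filter_upwards [Lp.coeFn_sub (shiftGroup i t (weightL2 ℓ n)) (weightL2 ℓ n),
      coeFn_shiftGroup t (weightL2 ℓ n), (shiftMap_preserving ℓ n i t)
        |>.quasiMeasurePreserving.ae (coeFn_weightL2 (ℓ := ℓ) (n := n)),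
      coeFn_weightL2 (ℓ := ℓ) (n := n)] with z hsub hshift hzt hz
    rw [hsub, Pi.sub_apply, hshift, hzt, hz, norm_weight, ← Complex.ofReal_sub,
      Complex.norm_real, Real.norm_eq_abs]
    exact abs_weight_shift_sub_le i ht hnt z
  exact hle.trans_eq (by ring)

theorem exists_sector_weight (ℓ : ℝ) [Fact (0 < ℓ)] (n : ℕ) : ∃ s : Sector ℓ n,
    (∀ᵐ z, s.fn z = (-1) ^ n * (weight z : ℂ)) ∧ (n = 0 → ∀ i, s.gradient i = 0) := by
  choose g hg hg_le using fun i => exists_hasGenerator_weightL2 (ℓ := ℓ) (n := n) i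
  refine ⟨.mk (((-1 : ℂ) ^ n) • weightL2 ℓ n) (Submodule.smul_mem _ _ weightL2_mem_nPhonon)
    (fun i => ((-1 : ℂ) ^ n) • g i) (fun i => hasGenerator_smul _ (hg i)), ?_, ?_⟩
  · filter_upwards [Lp.coeFn_smul ((-1 : ℂ) ^ n) (weightL2 ℓ n),
      coeFn_weightL2 (ℓ := ℓ) (n := n)] with z hsmul hz
    rw [Sector.fn_mk, hsmul, Pi.smul_apply, hz, smul_eq_mul]
  · rintro rfl i
    have hzero : g i = 0 := norm_le_zero_iff.1 (by simpa using hg_le i)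
    rw [Sector.gradient_mk, hzero, smul_zero]

end Weight

section Abstract

variable {H : Type*} [NormedAddCommGroup H] [InnerProductSpace ℂ H]

section Complete

variable [CompleteSpace H]

-- By the mean ergodic theorem, the averages of the orbit converge to the projection of `g`.
theorem exists_fixed_of_orbit_orthogonal {A : H →L[ℂ] H} (hA : ‖A‖ ≤ 1) {g Ψ : H}
    (h : ∀ k : ℕ, ⟪A^[k] g, Ψ⟫_ℂ = 0) :
    ∃ P : H, A P = P ∧ ⟪P, Ψ⟫_ℂ = 0 ∧ ∀ ω, A ω = ω → ⟪ω, P⟫_ℂ = ⟪ω, g⟫_ℂ := by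
  have hlim := A.tendsto_birkhoffAverage_orthogonalProjection hA g
  set P := (A.eqLocus (1 : H →L[ℂ] H)).orthogonalProjectionOnto g
  refine ⟨P, P.2, ?_, fun ω hω =>
    (A.eqLocus (1 : H →L[ℂ] H)).inner_orthogonalProjectionOnto_eq_of_mem_left ⟨ω, hω⟩ g⟩
  have haverage : ∀ N : ℕ, ⟪birkhoffAverage ℂ A _root_.id N g, Ψ⟫_ℂ = 0 := fun N => by
    simp only [birkhoffAverage, birkhoffSum, inner_smul_left, sum_inner, id_eq, h,
      Finset.sum_const_zero, mul_zero]
  refine tendsto_nhds_unique (hlim.inner tendsto_const_nhds) ?_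
  simp only [haverage]
  exact tendsto_const_nhds

end Complete

variable {G : Set (H × H)} {w : ℂ} {R : H →L[ℂ] H}

theorem IsResolvent.mem_graph_iff (hR : IsResolvent G w R) (μ : ℂ) (f Ψ : H) :
    (Ψ, (w + μ) • Ψ + f) ∈ G ↔ R (μ • Ψ + f) = Ψ := by
  rw [hR, add_smul, add_assoc]

theorem IsResolvent.isUnit_one_sub (hR : IsResolvent G w R) {μ : ℂ} {R' : H →L[ℂ] H}
    (hR' : IsResolvent G (w + μ) R') : IsUnit (1 - μ • R) := by
  have hfix : ∀ f, R (μ • R' f + f) = R' f := fun f =>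
    (hR.mem_graph_iff μ f (R' f)).1 ((hR' f (R' f)).1 rfl)
  have hright : (1 - μ • R) * (1 + μ • R') = 1 := by
    ext f
    change (f + μ • R' f) - μ • R (f + μ • R' f) = f
    rw [add_comm f, hfix, add_sub_cancel_left]
  have hinj : ∀ Ψ, (1 - μ • R) Ψ = 0 → Ψ = 0 := fun Ψ hΨ => by
    have hΨR : R (μ • Ψ + 0) = Ψ := by
      rw [add_zero, map_smul]
      exact (sub_eq_zero.1 hΨ).symm
    rw [← (hR' 0 Ψ).2 ((hR.mem_graph_iff μ 0 Ψ).2 hΨR), map_zero]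
  have hleft : (1 + μ • R') * (1 - μ • R) = 1 := by
    ext f
    refine sub_eq_zero.1 (hinj _ ?_)
    rw [map_sub, sub_eq_zero]
    have hcancel : (1 - μ • R) * ((1 + μ • R') * (1 - μ • R)) = (1 - μ • R) * 1 := by
      rw [← mul_assoc, hright, one_mul, mul_one]
    exact DFunLike.congr_fun hcancel f
  exact ⟨⟨_, _, hright, hleft⟩, rfl⟩

variable [CompleteSpace H]

theorem IsResolvent.neumann (hR : IsResolvent G w R) {μ : ℂ} (hμ : ‖μ • R‖ < 1) :
    IsResolvent G (w + μ) (R * Units.val (Units.oneSub (μ • R) hμ)⁻¹) := by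
  set U := Units.oneSub (μ • R) hμ
  have hcomm : R * Units.val U⁻¹ = Units.val U⁻¹ * R :=
    (((Commute.one_right R).sub_right ((Commute.refl R).smul_right μ)) :
      Commute R (U : H →L[ℂ] H)).units_inv_right
  intro f Ψ
  have hsolve : Units.val U⁻¹ (R f) = Ψ ↔ R f = Units.val U Ψ := by
    constructor
    · rintro rfl
      exact (DFunLike.congr_fun U.mul_inv (R f)).symm
    · intro h
      rw [h]
      exact DFunLike.congr_fun U.inv_mul Ψ
  rw [hR.mem_graph_iff, hcomm]
  refine hsolve.trans ?_
  change R f = Ψ - μ • R Ψ ↔ _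
  rw [map_add, map_smul, eq_sub_iff_add_eq, add_comm]

theorem IsResolvent.inv_norm_sub_mem_spec {lam : ℝ} (hR : IsResolvent G (-(lam : ℂ)) R)
    (hpos : R.IsPositive) (hR0 : R ≠ 0) : ((‖R‖⁻¹ - lam : ℝ) : ℂ) ∈ spec G := by
  rintro ⟨R', hR'⟩
  have hnorm : ‖R‖ ≠ 0 := norm_ne_zero_iff.2 hR0
  have : Nontrivial (H →L[ℂ] H) := ⟨⟨R, 0, hR0⟩⟩
  have hunit : IsUnit (1 - ((‖R‖⁻¹ : ℝ) : ℂ) • R) := by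
    refine hR.isUnit_one_sub (R' := R') ?_
    rwa [Complex.ofReal_sub, sub_eq_neg_add] at hR'
  have hspec : ‖R‖ ∈ spectrum ℝ R :=
    CStarAlgebra.norm_mem_spectrum_of_nonneg ((ContinuousLinearMap.nonneg_iff_isPositive R).2 hpos)
  have hfactor : algebraMap ℝ (H →L[ℂ] H) ‖R‖ - R
      = (‖R‖ : ℂ) • (1 - ((‖R‖⁻¹ : ℝ) : ℂ) • R) := by
    rw [smul_sub, smul_smul, ← Complex.ofReal_mul, mul_inv_cancel₀ hnorm, Complex.ofReal_one,
      one_smul, Algebra.algebraMap_eq_smul_one]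
    rfl
  refine spectrum.mem_iff.1 hspec ?_
  rw [hfactor]
  exact hunit.smul (Units.mk0 (‖R‖ : ℂ) (by exact_mod_cast hnorm))

theorem PositivityImproving.neumann {C : Set H} (hR : PositivityImproving C R)
    (hRC : Set.MapsTo R C C) (hC : ∀ c : ℝ, 0 ≤ c → ∀ u ∈ C, (c : ℂ) • u ∈ C) {μ : ℝ}
    (hμ₀ : 0 ≤ μ) (hμ : ‖(μ : ℂ) • R‖ < 1) :
    PositivityImproving C (R * Units.val (Units.oneSub ((μ : ℂ) • R) hμ)⁻¹) := by
  intro u hu w hw hu0 hw0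
  set B := (μ : ℂ) • R
  have hmem : ∀ k : ℕ, (B ^ k) u ∈ C := by
    intro k
    induction k with
    | zero => exact hu
    | succ k ih =>
      rw [pow_succ']
      exact hC μ hμ₀ _ (hRC ih)
  have hnonneg : ∀ k : ℕ, 0 ≤ ⟪R ((B ^ k) u), w⟫_ℂ := fun k => by
    rcases eq_or_ne ((B ^ k) u) 0 with h | h
    · rw [h, map_zero, inner_zero_left]
    · exact (hR _ (hmem k) w hw h hw0).le
  have hseries : HasSum (fun k => B ^ k) (Units.val (Units.oneSub B hμ)⁻¹) :=
    (summable_geometric_of_norm_lt_one hμ).hasSum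
  have hinner : HasSum (fun k => ⟪R ((B ^ k) u), w⟫_ℂ)
      ⟪R (Units.val (Units.oneSub B hμ)⁻¹ u), w⟫_ℂ :=
    (R.hasSum ((ContinuousLinearMap.apply ℂ H u).hasSum hseries)).map
      (AddMonoidHom.mk' (fun z => ⟪z, w⟫_ℂ) fun _ _ => inner_add_left _ _ _)
      (continuous_id.inner continuous_const)
  exact (hR u hu w hw hu0 hw0).trans_le (le_hasSum hinner 0 fun k _ => hnonneg k)

theorem norm_smul_lt_one_of_lt_inv_norm {μ : ℝ} (hμ₀ : 0 ≤ μ) (hμ : μ < ‖R‖⁻¹) :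
    ‖(μ : ℂ) • R‖ < 1 := by
  rw [norm_smul, Complex.norm_real, Real.norm_of_nonneg hμ₀]
  exact (lt_div_iff₀ (inv_pos.1 (hμ₀.trans_lt hμ))).1 (by rwa [one_div])

-- The infimum is `‖R‖⁻¹ - lam₀`: this is a spectral point, and below it the resolvent is the
-- Neumann series in `R`.
theorem exists_isGLB_spec_forall_positivityImproving {C : Set H} {lam₀ : ℝ}
    (hC : ∀ c : ℝ, 0 ≤ c → ∀ u ∈ C, (c : ℂ) • u ∈ C) (hne : ∃ u ∈ C, u ≠ 0)
    (hR : IsResolvent G (-(lam₀ : ℂ)) R) (hpos : R.IsPositive) (hRC : Set.MapsTo R C C)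
    (himp : PositivityImproving C R)
    (hlarge : ∀ lam : ℝ, lam₀ < lam →
      ∃ R' : H →L[ℂ] H, IsResolvent G (-(lam : ℂ)) R' ∧ PositivityImproving C R') :
    ∃ E : ℝ, IsGLB {s : ℝ | (s : ℂ) ∈ spec G} E ∧ ∀ lam : ℝ, -E < lam →
      ∃ R' : H →L[ℂ] H, IsResolvent G (-(lam : ℂ)) R' ∧ PositivityImproving C R' := by
  obtain ⟨u, hu, hu0⟩ := hne
  have hR0 : R ≠ 0 := by
    rintro rfl
    simpa using himp u hu u hu hu0 hu0
  have hall : ∀ lam : ℝ, -(‖R‖⁻¹ - lam₀) < lam →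
      ∃ R' : H →L[ℂ] H, IsResolvent G (-(lam : ℂ)) R' ∧ PositivityImproving C R' := by
    intro lam hlam
    rcases lt_or_ge lam₀ lam with h | h
    · exact hlarge lam h
    · have hμ₀ : 0 ≤ lam₀ - lam := sub_nonneg.2 h
      have hμ := norm_smul_lt_one_of_lt_inv_norm (R := R) hμ₀ (by linarith)
      have hpoint : -(lam : ℂ) = -(lam₀ : ℂ) + ((lam₀ - lam : ℝ) : ℂ) := by push_cast; ring
      exact ⟨_, hpoint ▸ hR.neumann hμ, himp.neumann hRC hC hμ₀ hμ⟩
  refine ⟨‖R‖⁻¹ - lam₀, ⟨fun s hs => ?_, fun b hb => hb (hR.inv_norm_sub_mem_spec hpos hR0)⟩, hall⟩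
  by_contra! hlt
  obtain ⟨R', hR', -⟩ := hall (-s) (neg_lt_neg hlt)
  rw [Complex.ofReal_neg, neg_neg] at hR'
  exact hs ⟨R', hR'⟩

end Abstract

section TestVector

variable {ℓ : ℝ} [Fact (0 < ℓ)] {n : ℕ}

theorem ae_of_ae_comp_snocMap {P : Conf ℓ (n + 1) → Prop}
    (h : ∀ᵐ x : Conf ℓ n × R3, P (snocMap x)) : ∀ᵐ z, P z := by
  rw [← snocMap_preserving.map_eq]
  exact measurableEmbedding_snocMap.ae_map_iff.2 h

theorem eq_zero_of_pairKernel_eq_zero {φ : L2 ℓ n} {ψ : L2 ℓ (n + 1)} (hφ : ∀ᵐ z, φ z ≠ 0)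
    (h : ∀ᵐ x, pairKernel φ ψ x = 0) : ψ = 0 := by
  rw [Lp.eq_zero_iff_ae_eq_zero]
  refine ae_of_ae_comp_snocMap ?_
  filter_upwards [h, ae_comp_fst hφ, ae_ne_zero_snd] with x hx hφx hx2
  have hconj : starRingEnd ℂ (φ x.1) ≠ 0 := (map_ne_zero _).2 hφx
  have hv : (v x.2 : ℂ) ≠ 0 := Complex.ofReal_ne_zero.2 (v_pos hx2).ne'
  exact (mul_eq_zero.1 ((mul_eq_zero.1 hx).resolve_left hconj)).resolve_left hv

theorem comp_smul (c : ℂ) (Ψ : Hilb ℓ) (n : ℕ) : comp (c • Ψ) n = c • comp Ψ n := rfl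

theorem smul_mem_cone {Ψ : Hilb ℓ} (h : Ψ ∈ cone ℓ) {c : ℝ} (hc : 0 ≤ c) :
    (c : ℂ) • Ψ ∈ cone ℓ := by
  intro n
  rw [comp_smul]
  filter_upwards [h n, Lp.coeFn_smul (c : ℂ) (comp Ψ n)] with z hz hsmul
  rw [hsmul, Pi.smul_apply, smul_eq_mul, mul_left_comm]
  exact mul_nonneg (Complex.zero_le_real.2 hc) hz

/-- The element of the Hilbert space whose only non-zero component is `f`, in the `n`-phonon
sector. -/
abbrev single (n : ℕ) (f : nPhonon ℓ n) : Hilb ℓ := lp.single 2 n f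

theorem comp_single_self (f : nPhonon ℓ n) : comp (single n f) n = f :=
  congrArg Subtype.val (lp.single_apply_self (E := fun n => nPhonon ℓ n) 2 n f)

theorem comp_single_of_ne (f : nPhonon ℓ n) {m : ℕ} (h : m ≠ n) : comp (single n f) m = 0 :=
  congrArg Subtype.val (lp.single_apply_ne (E := fun n => nPhonon ℓ n) 2 n f h)

theorem inner_single_left (f : nPhonon ℓ n) (Ψ : Hilb ℓ) :
    ⟪single n f, Ψ⟫_ℂ = ⟪(f : L2 ℓ n), comp Ψ n⟫_ℂ := by
  rw [lp.inner_single_left, Submodule.coe_inner, comp]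

theorem single_mem_cone {f : nPhonon ℓ n} (hf : ∀ᵐ z, (0 : ℂ) ≤ (-1) ^ n * (f : L2 ℓ n) z) :
    single n f ∈ cone ℓ := by
  intro m
  rcases eq_or_ne m n with rfl | hm
  · rwa [comp_single_self]
  · rw [comp_single_of_ne f hm]
    filter_upwards [Lp.coeFn_zero ℂ 2 (volume : Measure (Conf ℓ m))] with z hz
    rw [hz, Pi.zero_apply, mul_zero]

/-- The function `(-1)ⁿ weight`, as an element of the `n`-phonon form domain. -/
def weightSector (ℓ : ℝ) [Fact (0 < ℓ)] (n : ℕ) : Sector ℓ n := (exists_sector_weight ℓ n).choose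

theorem coeFn_weightSector (n : ℕ) :
    ∀ᵐ z, (weightSector ℓ n).fn z = (-1) ^ n * (weight z : ℂ) :=
  (exists_sector_weight ℓ n).choose_spec.1

theorem gradient_weightSector_zero (i : Fin 3) : (weightSector ℓ 0).gradient i = 0 :=
  (exists_sector_weight ℓ 0).choose_spec.2 rfl i

theorem weightSector_ae_ne_zero (n : ℕ) : ∀ᵐ z, (weightSector ℓ n).fn z ≠ 0 := by
  filter_upwards [coeFn_weightSector (ℓ := ℓ) n] with z hz
  rw [hz]
  exact mul_ne_zero (pow_ne_zero n (neg_ne_zero.2 one_ne_zero))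
    (Complex.ofReal_ne_zero.2 (weight_pos z).ne')

/-- An element of the form domain that is supported in the `n`-phonon sector and is strictly
positive there with respect to the cone. -/
def testVector (ℓ : ℝ) [Fact (0 < ℓ)] (n : ℕ) : FormSpace ℓ := lp.single 2 n (weightSector ℓ n)

theorem testVector_self (n : ℕ) : testVector ℓ n n = weightSector ℓ n :=
  lp.single_apply_self 2 n _

theorem testVector_of_ne {m : ℕ} (h : m ≠ n) : testVector ℓ n m = 0 :=
  lp.single_apply_ne 2 n _ h

theorem embed_testVector (n : ℕ) : embed ℓ (testVector ℓ n)
    = single n ⟨(weightSector ℓ n).fn, (weightSector ℓ n).fn_mem⟩ := by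
  refine Hilb_ext fun m => ?_
  rw [comp_embed]
  rcases eq_or_ne m n with rfl | hm
  · rw [testVector_self, comp_single_self]
  · rw [testVector_of_ne hm, comp_single_of_ne _ hm, Sector.fn_zero]

theorem testVector_mem_cone (n : ℕ) : embed ℓ (testVector ℓ n) ∈ cone ℓ := by
  rw [embed_testVector]
  refine single_mem_cone ?_
  filter_upwards [coeFn_weightSector (ℓ := ℓ) n] with z hz
  rw [hz, ← mul_assoc, neg_one_pow_mul_self, one_mul]
  exact Complex.zero_le_real.2 (weight_pos z).le

theorem comp_eq_zero_of_inner_testVector {u : Hilb ℓ} (hu : u ∈ cone ℓ)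
    (h : ⟪embed ℓ (testVector ℓ n), u⟫_ℂ = 0) : comp u n = 0 := by
  rw [Lp.eq_zero_iff_ae_eq_zero]
  filter_upwards [ae_norm_mul_norm_eq_zero (testVector_mem_cone n) hu h n,
    weightSector_ae_ne_zero (ℓ := ℓ) n] with z hz hweight
  rw [comp_embed, testVector_self, mul_eq_zero, norm_eq_zero, norm_eq_zero] at hz
  exact hz.resolve_left hweight

instance isOpenPosMeasure_conf (n : ℕ) : (volume : Measure (Conf ℓ n)).IsOpenPosMeasure := by
  have : (volume : Measure (Torus ℓ)).IsOpenPosMeasure := Measure.pi.isOpenPosMeasure _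
  have : (volume : Measure (Fin n → R3)).IsOpenPosMeasure := Measure.pi.isOpenPosMeasure _
  exact Measure.prod.instIsOpenPosMeasure

theorem embed_testVector_ne_zero (n : ℕ) : embed ℓ (testVector ℓ n) ≠ 0 := by
  intro h
  have hzero : (weightSector ℓ n).fn = 0 := by
    rw [← testVector_self, ← comp_embed, h]
    rfl
  rw [Lp.eq_zero_iff_ae_eq_zero] at hzero
  obtain ⟨z, hz, hz'⟩ := (hzero.and (weightSector_ae_ne_zero n)).exists
  exact hz' hz

-- The witness is `(-1)ⁿ weight` restricted to the zero set of the component of `Ψ`.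
theorem exists_mem_cone_inner_eq_zero (Ψ : Hilb ℓ) (n : ℕ) :
    ∃ g ∈ cone ℓ, ⟪g, Ψ⟫_ℂ = 0 ∧ ∀ᵐ z, comp Ψ n z = 0 → comp g n z ≠ 0 := by
  set A : Set (Conf ℓ n) := {z | comp Ψ n z = 0}
  have hA : MeasurableSet A :=
    (Lp.stronglyMeasurable (comp Ψ n)).measurable (measurableSet_singleton 0)
  have hF : MemLp (A.indicator (weightSector ℓ n).fn) 2 volume := (Lp.memLp _).indicator hA
  have hFc := hF.coeFn_toLp
  have hmem : hF.toLp _ ∈ nPhonon ℓ n := mem_nPhonon_iff_ae.2 fun σ => by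
    filter_upwards [hFc, (permMap_preserving ℓ n σ).quasiMeasurePreserving.ae hFc,
      mem_nPhonon_iff_ae.1 (Ψ n).2 σ, mem_nPhonon_iff_ae.1 (weightSector ℓ n).fn_mem σ]
      with z hz hσz hΨ hweight
    have hAσ : permMap ℓ n σ z ∈ A ↔ z ∈ A := by
      change comp Ψ n (permMap ℓ n σ z) = 0 ↔ comp Ψ n z = 0
      rw [show comp Ψ n (permMap ℓ n σ z) = comp Ψ n z from hΨ]
    classical
    simp only [hz, hσz, Set.indicator_apply, hAσ, hweight]
  refine ⟨single n ⟨_, hmem⟩, single_mem_cone ?_, ?_, ?_⟩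
  · filter_upwards [hFc, coeFn_weightSector (ℓ := ℓ) n] with z hz hweight
    rw [hz]
    by_cases hzA : z ∈ A
    · rw [Set.indicator_of_mem hzA, hweight, ← mul_assoc, neg_one_pow_mul_self, one_mul]
      exact Complex.zero_le_real.2 (weight_pos z).le
    · rw [Set.indicator_of_notMem hzA, mul_zero]
  · rw [inner_single_left, L2.inner_def]
    refine integral_eq_zero_of_ae ?_
    filter_upwards [hFc] with z hz
    by_cases hzA : z ∈ A
    · rw [show comp Ψ n z = 0 from hzA, inner_zero_right, Pi.zero_apply]
    · rw [hz, Set.indicator_of_notMem hzA, inner_zero_left, Pi.zero_apply]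
  · rw [comp_single_self]
    filter_upwards [hFc, weightSector_ae_ne_zero (ℓ := ℓ) n] with z hz hweight hzA
    rwa [hz, Set.indicator_of_mem (show z ∈ A from hzA)]

theorem ae_ne_zero_of_forall_orthogonal {Ψ : Hilb ℓ}
    (h : ∀ g ∈ cone ℓ, ⟪g, Ψ⟫_ℂ = 0 → comp g n = 0) : ∀ᵐ z, comp Ψ n z ≠ 0 := by
  obtain ⟨g, hg, hgΨ, hne⟩ := exists_mem_cone_inner_eq_zero Ψ n
  filter_upwards [hne, (Lp.eq_zero_iff_ae_eq_zero).1 (h g hg hgΨ)] with z hz hgz hΨz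
  exact hz hΨz hgz

end TestVector

section Comparison

variable {ℓ : ℝ} [Fact (0 < ℓ)] {α lam lam' : ℝ} {p q : FormSpace ℓ} {u : Hilb ℓ}

/-- `p` is the weak solution of `(h_ℓ + lam) p = u`, with `u` and `p` in the cone. -/
structure IsConeSolution (α lam : ℝ) (p : FormSpace ℓ) (u : Hilb ℓ) : Prop where
  isSolution : IsSolution α lam p u
  source_mem : u ∈ cone ℓ
  embed_mem : embed ℓ p ∈ cone ℓ

theorem inner_formOp_zero (lam : ℝ) (q p : FormSpace ℓ) : ⟪q, formOp ℓ 0 lam p⟫_ℂ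
    = ⟪q, p⟫_ℂ + ((lam - 1 : ℝ) : ℂ) * ⟪embed ℓ q, embed ℓ p⟫_ℂ := by
  rw [inner_formOp, Real.sqrt_zero, Complex.ofReal_zero, zero_mul, add_zero]

theorem inner_testVector_formOp_zero {n : ℕ} (h : (p n).fn = 0) :
    ⟪testVector ℓ n, formOp ℓ 0 lam p⟫_ℂ = 0 := by
  have hp : p n = 0 := Sector.fn_injective (h.trans Sector.fn_zero.symm)
  rw [inner_formOp_zero, testVector, lp.inner_single_left, hp, ← testVector, embed_testVector,
    inner_single_left, comp_embed, h, inner_zero_right, inner_zero_right, mul_zero, add_zero]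

theorem IsSolution.inner_formOp_zero_eq (hp : IsSolution α lam p u) (lam' : ℝ)
    (q : FormSpace ℓ) : ⟪q, formOp ℓ 0 lam' p⟫_ℂ
      = ⟪embed ℓ q, u⟫_ℂ + ((lam' - lam : ℝ) : ℂ) * ⟪embed ℓ q, embed ℓ p⟫_ℂ
        + (√α : ℂ) * (-intForm q p + -starRingEnd ℂ (intForm p q)) := by
  have h := hp q
  rw [inner_formOp] at h
  rw [inner_formOp_zero]
  push_cast at h ⊢
  linear_combination h

-- On the cone the interaction is non-positive, so the free form of the solution is a sum of
-- non-negative terms.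
theorem IsConeSolution.terms_eq_zero (hα : 0 < α) (hp : IsConeSolution α lam p u)
    (hlam : lam < lam') (hq : embed ℓ q ∈ cone ℓ) (h : ⟪q, formOp ℓ 0 lam' p⟫_ℂ = 0) :
    ⟪embed ℓ q, u⟫_ℂ = 0 ∧ ⟪embed ℓ q, embed ℓ p⟫_ℂ = 0 ∧ intForm q p = 0 ∧ intForm p q = 0 := by
  have hsource := inner_nonneg_of_mem_cone hq hp.source_mem
  have hgap : (0 : ℂ) < ((lam' - lam : ℝ) : ℂ) := Complex.zero_lt_real.2 (sub_pos.2 hlam)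
  have hmass := mul_nonneg hgap.le (inner_nonneg_of_mem_cone hq hp.embed_mem)
  have hcoupling : (0 : ℂ) < (√α : ℂ) := Complex.zero_lt_real.2 (Real.sqrt_pos.2 hα)
  have hqp := neg_nonneg.2 (intForm_nonpos_of_mem_cone hq hp.embed_mem)
  have hpq : 0 ≤ -starRingEnd ℂ (intForm p q) := by
    rw [← map_neg]
    exact star_nonneg_iff.2 (neg_nonneg.2 (intForm_nonpos_of_mem_cone hp.embed_mem hq))
  rw [hp.isSolution.inner_formOp_zero_eq,
    add_eq_zero_iff_of_nonneg (add_nonneg hsource hmass) (mul_nonneg hcoupling.le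
      (add_nonneg hqp hpq)), add_eq_zero_iff_of_nonneg hsource hmass, mul_eq_zero, mul_eq_zero,
    or_iff_right hgap.ne', or_iff_right hcoupling.ne', add_eq_zero_iff_of_nonneg hqp hpq,
    neg_eq_zero, neg_eq_zero, map_eq_zero] at h
  exact ⟨h.1.1, h.1.2, h.2⟩

theorem pairKernel_ae_eq_zero_of_intForm_eq_zero (hp : embed ℓ p ∈ cone ℓ)
    (hq : embed ℓ q ∈ cone ℓ) (h : intForm p q = 0) (n : ℕ) :
    ∀ᵐ x, pairKernel (p n).fn (q (n + 1)).fn x = 0 := by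
  have hsum := hasSum_intForm_of_mem_cone hp hq
  rw [h, neg_zero, Complex.zero_re, hasSum_zero_iff_of_nonneg fun n => by positivity] at hsum
  have hinteraction : ∫ x, ‖pairKernel (p n).fn (q (n + 1)).fn x‖ = 0 :=
    (mul_eq_zero.1 (congrFun hsum n)).resolve_left (by positivity)
  filter_upwards [(integral_eq_zero_iff_of_nonneg (fun x => norm_nonneg _)
    (integrable_pairKernel (p n).fn (q (n + 1))).norm).1 hinteraction] with x hx
  exact norm_eq_zero.1 hx

theorem IsConeSolution.testVector_terms_eq_zero (hα : 0 < α) (hp : IsConeSolution α lam p u)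
    {n : ℕ} (h : (p n).fn = 0) :
    ⟪embed ℓ (testVector ℓ n), u⟫_ℂ = 0 ∧ intForm (testVector ℓ n) p = 0 := by
  obtain ⟨hu, -, hinteraction, -⟩ := hp.terms_eq_zero hα (lt_add_one lam) (testVector_mem_cone n)
    (inner_testVector_formOp_zero h)
  exact ⟨hu, hinteraction⟩

-- If the vacuum component vanished, the comparison would propagate the zero to all sectors.
theorem IsConeSolution.fn_zero_ne_zero (hα : 0 < α) (hp : IsConeSolution α lam p u)
    (hu : u ≠ 0) : (p 0).fn ≠ 0 := by
  intro h0
  have hall : ∀ n, (p n).fn = 0 := by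
    intro n
    induction n with
    | zero => exact h0
    | succ n ih =>
      refine eq_zero_of_pairKernel_eq_zero (weightSector_ae_ne_zero n) ?_
      simpa only [testVector_self] using pairKernel_ae_eq_zero_of_intForm_eq_zero
        (testVector_mem_cone n) hp.embed_mem (hp.testVector_terms_eq_zero hα ih).2 n
  exact hu (Hilb_ext fun n =>
    comp_eq_zero_of_inner_testVector hp.source_mem (hp.testVector_terms_eq_zero hα (hall n)).1)

end Comparison

section Vacuum

theorem exists_const_of_forall_ae_add_eq {G β : Type*} [AddGroup G] [MeasurableSpace G]
    [MeasurableAdd₂ G] {μ : Measure G} [SFinite μ] [μ.IsAddLeftInvariant] [MeasurableSpace β]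
    [MeasurableEq β] {f : G → β} (hf : Measurable f) (h : ∀ a, ∀ᵐ z ∂μ, f (z + a) = f z) :
    ∃ c, ∀ᵐ z ∂μ, f z = c := by
  rcases eq_or_neBot (ae μ) with hbot | _
  · exact ⟨f 0, hbot ▸ mem_bot⟩
  have hmeas : MeasurableSet {x : G × G | f (x.2 + x.1) = f x.2} :=
    measurableSet_eq_fun (hf.comp (measurable_snd.add measurable_fst)) (hf.comp measurable_snd)
  obtain ⟨z, hz⟩ := ((Measure.ae_ae_comm (p := fun a z => f (z + a) = f z) hmeas).1
    (Eventually.of_forall h : ∀ᵐ a ∂μ, ∀ᵐ z ∂μ, f (z + a) = f z)).exists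
  refine ⟨f z, ?_⟩
  filter_upwards [(measurePreserving_add_left μ (-z)).quasiMeasurePreserving.ae hz] with a ha
  rwa [add_neg_cancel_left] at ha

variable {ℓ : ℝ}

theorem exists_eq_displacement_add (a : Conf ℓ 0) : ∃ t : Fin 3 → ℝ,
    a = displacement ℓ 0 0 (t 0) + (displacement ℓ 0 1 (t 1) + displacement ℓ 0 2 (t 2)) := by
  choose t ht using fun k => QuotientAddGroup.mk_surjective (a.1 k)
  refine ⟨t, Prod.ext (funext fun k => ?_) (Subsingleton.elim _ _)⟩
  rw [← ht k]
  fin_cases k <;> simp [displacement]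

variable [Fact (0 < ℓ)] {n : ℕ} {lam : ℝ}

theorem ae_add_displacement_eq {f : L2 ℓ n} {i : Fin 3} (h : (shiftGroup i).HasGenerator f 0)
    (t : ℝ) : ∀ᵐ z, f (z + displacement ℓ n i t) = f z := by
  have hfix : shiftGroup i t f = f :=
    sub_eq_zero.1 (norm_le_zero_iff.1 (by simpa only [norm_zero, zero_mul] using h.norm_sub_le t))
  filter_upwards [hfix ▸ coeFn_shiftGroup (i := i) t f] with z hz
  exact hz.symm

theorem isAddLeftInvariant_volume (ℓ : ℝ) [Fact (0 < ℓ)] (n : ℕ) :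
    (volume : Measure (Conf ℓ n)).IsAddLeftInvariant :=
  ⟨fun a => ((volume_preserving_pi fun k =>
      measurePreserving_add_left (volume : Measure (AddCircle ℓ)) (a.1 k)).prod
    (volume_preserving_pi fun j =>
      measurePreserving_add_left (volume : Measure R3) (a.2 j))).map_eq⟩

theorem exists_const_of_hasGenerator_zero {f : L2 ℓ 0}
    (h : ∀ i, (shiftGroup i).HasGenerator f 0) : ∃ c : ℂ, ∀ᵐ z, f z = c := by
  have := isAddLeftInvariant_volume ℓ 0
  refine exists_const_of_forall_ae_add_eq (Lp.stronglyMeasurable f).measurable fun a => ?_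
  obtain ⟨t, rfl⟩ := exists_eq_displacement_add a
  have hshift := fun i => ae_add_displacement_eq (h i) (t i)
  have hmap := fun i => (shiftMap_preserving ℓ 0 i (t i)).quasiMeasurePreserving
  filter_upwards [hshift 0, (hmap 0).ae (hshift 1), (hmap 0).ae ((hmap 1).ae (hshift 2))]
    with z h0 h1 h2
  simp only [shiftMap] at h1 h2
  rw [← add_assoc, ← add_assoc, h2, h1, h0]

/-- The phonon vacuum, with the electron in the constant wave function `1`. -/
abbrev vacuum (ℓ : ℝ) [Fact (0 < ℓ)] : Hilb ℓ := embed ℓ (testVector ℓ 0)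

theorem isSolution_vacuum (lam : ℝ) :
    IsSolution 0 lam (testVector ℓ 0) ((lam : ℂ) • vacuum ℓ) := by
  intro q
  have hform : ⟪q, testVector ℓ 0⟫_ℂ = ⟪embed ℓ q, vacuum ℓ⟫_ℂ := by
    rw [vacuum, embed_testVector, testVector, lp.inner_single_right, lp.inner_single_right,
      Sector.inner_eq]
    simp only [gradient_weightSector_zero, inner_zero_right, Finset.sum_const_zero, Nat.cast_zero,
      zero_mul, add_zero]
    rfl
  rw [inner_formOp_zero, hform, inner_smul_right]
  push_cast
  ring

theorem IsSolution.energy_eq_zero {q : FormSpace ℓ}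
    (h : IsSolution 0 lam q ((lam : ℂ) • embed ℓ q)) (n : ℕ) :
    (∑ i, ‖(q n).gradient i‖ ^ 2) = 0 ∧ n * ‖(q n).fn‖ ^ 2 = 0 := by
  have hnorm : ‖q‖ ^ 2 = ‖embed ℓ q‖ ^ 2 := by
    have hq := h q
    rw [inner_formOp_zero, inner_smul_right, inner_self_eq_norm_sq_to_K,
      inner_self_eq_norm_sq_to_K] at hq
    simp only [Complex.coe_algebraMap] at hq
    norm_cast at hq
    linarith
  have hsum := (lp_two_hasSum_norm_sq q).sub (hasSum_norm_comp_sq (embed ℓ q))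
  simp only [hnorm, sub_self, Sector.norm_sq_eq, comp_embed, add_sub_cancel_left] at hsum
  rw [hasSum_zero_iff_of_nonneg fun n => by positivity] at hsum
  exact (add_eq_zero_iff_of_nonneg (by positivity) (by positivity)).1 (congrFun hsum n)

theorem IsSolution.exists_eq_smul_vacuum {q : FormSpace ℓ}
    (h : IsSolution 0 lam q ((lam : ℂ) • embed ℓ q)) : ∃ c : ℂ, embed ℓ q = c • vacuum ℓ := by
  have hgrad : ∀ i, (q 0).gradient i = 0 := fun i => by
    have hi := (Finset.sum_eq_zero_iff_of_nonneg fun k _ => by positivity).1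
      (h.energy_eq_zero 0).1 i (Finset.mem_univ i)
    exact norm_eq_zero.1 (pow_eq_zero_iff two_ne_zero |>.1 hi)
  obtain ⟨c, hc⟩ := exists_const_of_hasGenerator_zero fun i =>
    hgrad i ▸ (q 0).hasGenerator_fn i
  refine ⟨c, Hilb_ext fun n => ?_⟩
  rw [comp_smul, comp_embed, comp_embed]
  rcases Nat.eq_zero_or_pos n with rfl | hn
  · rw [testVector_self]
    refine Lp.ext ?_
    filter_upwards [hc, Lp.coeFn_smul c (weightSector ℓ 0).fn, coeFn_weightSector (ℓ := ℓ) 0]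
      with z hz hsmul hweight
    rw [hz, hsmul, Pi.smul_apply, hweight]
    simp [weight]
  · rw [testVector_of_ne hn.ne', Sector.fn_zero, smul_zero]
    have hfn := (mul_eq_zero.1 (h.energy_eq_zero n).2).resolve_left (Nat.cast_ne_zero.2 hn.ne')
    exact norm_eq_zero.1 (pow_eq_zero_iff two_ne_zero |>.1 hfn)

end Vacuum

section FreeResolvent

variable {ℓ : ℝ} [Fact (0 < ℓ)] {lam : ℝ} {R : Hilb ℓ →L[ℂ] Hilb ℓ}

theorem IsSolution.norm_embed_le_of_free {q : FormSpace ℓ} {g : Hilb ℓ}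
    (h : IsSolution 0 lam q g) : lam * ‖embed ℓ q‖ ≤ ‖g‖ := by
  have hform : ‖q‖ ^ 2 + (lam - 1) * ‖embed ℓ q‖ ^ 2 = (⟪embed ℓ q, g⟫_ℂ).re := by
    rw [← h q, re_inner_formOp_self, Real.sqrt_zero, zero_mul, add_zero]
  have hcauchy := (Complex.re_le_norm ⟪embed ℓ q, g⟫_ℂ).trans (norm_inner_le_norm (embed ℓ q) g)
  have hembed := pow_le_pow_left₀ (norm_nonneg _) (norm_embed_le q) 2
  rcases (norm_nonneg (embed ℓ q)).eq_or_lt with h0 | h0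
  · rw [← h0, mul_zero]
    exact norm_nonneg g
  · exact le_of_mul_le_mul_left (by linarith) h0

theorem IsSolutionOperator.norm_smul_le_one (hR : IsSolutionOperator 0 lam R) (hlam : 0 ≤ lam) :
    ‖(lam : ℂ) • R‖ ≤ 1 := by
  refine ContinuousLinearMap.opNorm_le_bound _ zero_le_one fun f => ?_
  obtain ⟨q, hRf, hq⟩ := hR f
  rw [smul_apply, hRf, norm_smul, Complex.norm_real, Real.norm_of_nonneg hlam, one_mul]
  exact hq.norm_embed_le_of_free

-- The fixed vectors of `lam • R` are the multiples of the vacuum.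
theorem IsSolutionOperator.inner_vacuum_eq_zero (hR : IsSolutionOperator 0 lam R)
    (hS : IsCoerciveOperator (formOp ℓ 0 lam)) (hlam : 0 ≤ lam) {g Ψ : Hilb ℓ}
    (h : ∀ k : ℕ, ⟪((lam : ℂ) • R)^[k] g, Ψ⟫_ℂ = 0) (hΨ : ⟪vacuum ℓ, Ψ⟫_ℂ ≠ 0) :
    ⟪vacuum ℓ, g⟫_ℂ = 0 := by
  obtain ⟨P, hP, hPΨ, hproj⟩ := exists_fixed_of_orbit_orthogonal (hR.norm_smul_le_one hlam) h
  have hvacuum : ((lam : ℂ) • R) (vacuum ℓ) = vacuum ℓ := by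
    rw [smul_apply, ← map_smul]
    exact hR.apply_eq hS (isSolution_vacuum lam)
  obtain ⟨q, hRP, hq⟩ := hR ((lam : ℂ) • P)
  obtain rfl : P = embed ℓ q := by
    rw [← hRP, map_smul]
    exact hP.symm
  obtain ⟨c, hc⟩ := hq.exists_eq_smul_vacuum
  rw [hc, inner_smul_left, mul_eq_zero, or_iff_left hΨ, map_eq_zero] at hPΨ
  rw [← hproj _ hvacuum, hc, hPΨ, zero_smul, inner_zero_right]

end FreeResolvent

section Improving

variable {ℓ : ℝ} [Fact (0 < ℓ)] {α lam lam' : ℝ} {p : FormSpace ℓ} {u g : Hilb ℓ}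
  {R : Hilb ℓ →L[ℂ] Hilb ℓ}

theorem exists_isSolutionOperator (hS : IsCoerciveOperator (formOp ℓ α lam)) :
    ∃ R : Hilb ℓ →L[ℂ] Hilb ℓ, R.IsPositive ∧ IsSolutionOperator α lam R :=
  exists_isPositive_forall_isWeakSolution (embed ℓ) hS (formOp_symm α lam)

theorem IsSolutionOperator.exists_isConeSolution (hR : IsSolutionOperator α lam R)
    (hS : IsCoerciveOperator (formOp ℓ α lam)) (hg : g ∈ cone ℓ) :
    ∃ q, R g = embed ℓ q ∧ IsConeSolution α lam q g := by
  obtain ⟨q, hRg, hq⟩ := hR g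
  exact ⟨q, hRg, hq, hg, hq.embed_mem_cone hS hg⟩

theorem IsConeSolution.orthogonal_of_free (hα : 0 < α) (hp : IsConeSolution α lam p u)
    (hlam : lam < lam') {q : FormSpace ℓ} (hq : IsConeSolution 0 lam' q g)
    (h : ⟪g, embed ℓ p⟫_ℂ = 0) : ⟪embed ℓ q, embed ℓ p⟫_ℂ = 0 ∧ intForm p q = 0 := by
  have hfree : ⟪q, formOp ℓ 0 lam' p⟫_ℂ = 0 := by
    rw [← formOp_symm, ← inner_conj_symm, hq.isSolution p, inner_conj_symm, h]
  obtain ⟨-, hinner, -, hinteraction⟩ := hp.terms_eq_zero hα hlam hq.embed_mem hfree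
  exact ⟨hinner, hinteraction⟩

theorem IsConeSolution.iterate_free_orthogonal (hα : 0 < α) (hp : IsConeSolution α lam p u)
    (hlam : lam < lam') (hlam' : 0 ≤ lam') (hR : IsSolutionOperator 0 lam' R)
    (hS : IsCoerciveOperator (formOp ℓ 0 lam')) (hg : g ∈ cone ℓ)
    (h : ⟪g, embed ℓ p⟫_ℂ = 0) (k : ℕ) :
    ((lam' : ℂ) • R)^[k] g ∈ cone ℓ ∧ ⟪((lam' : ℂ) • R)^[k] g, embed ℓ p⟫_ℂ = 0 := by
  induction k with
  | zero => exact ⟨hg, h⟩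
  | succ k ih =>
    obtain ⟨q, hRq, hq⟩ := hR.exists_isConeSolution hS ih.1
    rw [Function.iterate_succ_apply', smul_apply, hRq]
    refine ⟨smul_mem_cone hq.embed_mem hlam', ?_⟩
    rw [inner_smul_left, (hp.orthogonal_of_free hα hlam hq ih.2).1, mul_zero]

theorem IsConeSolution.vacuum_ae_ne_zero (hα : 0 < α) (hp : IsConeSolution α lam p u)
    (hu : u ≠ 0) (hlam : lam < lam') (hlam' : 0 ≤ lam') (hR : IsSolutionOperator 0 lam' R)
    (hS : IsCoerciveOperator (formOp ℓ 0 lam')) : ∀ᵐ z, (p 0).fn z ≠ 0 := by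
  refine ae_ne_zero_of_forall_orthogonal (Ψ := embed ℓ p) fun g hg hgp => ?_
  have hvacuum : ⟪vacuum ℓ, embed ℓ p⟫_ℂ ≠ 0 := fun h =>
    hp.fn_zero_ne_zero hα hu (comp_eq_zero_of_inner_testVector hp.embed_mem h)
  exact comp_eq_zero_of_inner_testVector hg (hR.inner_vacuum_eq_zero hS hlam'
    (fun k => (hp.iterate_free_orthogonal hα hlam hlam' hR hS hg hgp k).2) hvacuum)

theorem IsConeSolution.succ_ae_ne_zero (hα : 0 < α) (hp : IsConeSolution α lam p u)
    (hlam : lam < lam') (hR : IsSolutionOperator 0 lam' R)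
    (hS : IsCoerciveOperator (formOp ℓ 0 lam')) {n : ℕ} (hn : ∀ᵐ z, (p n).fn z ≠ 0) :
    ∀ᵐ z, (p (n + 1)).fn z ≠ 0 := by
  refine ae_ne_zero_of_forall_orthogonal (Ψ := embed ℓ p) fun g hg hgp => ?_
  obtain ⟨q, -, hq⟩ := hR.exists_isConeSolution hS hg
  have hinteraction := (hp.orthogonal_of_free hα hlam hq hgp).2
  have hzero : (q (n + 1)).fn = 0 := eq_zero_of_pairKernel_eq_zero hn
    (pairKernel_ae_eq_zero_of_intForm_eq_zero hp.embed_mem hq.embed_mem hinteraction n)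
  refine comp_eq_zero_of_inner_testVector hg ?_
  rw [← hq.isSolution, inner_testVector_formOp_zero hzero]

theorem IsConeSolution.ae_ne_zero (hα : 0 < α) (hp : IsConeSolution α lam p u) (hu : u ≠ 0)
    (n : ℕ) : ∀ᵐ z, (p n).fn z ≠ 0 := by
  obtain ⟨lam₀, hlam₀, hcoercive⟩ := exists_isCoerciveOperator_formOp 0
  have hS := hcoercive ℓ (max lam₀ (lam + 1)) (le_max_left _ _)
  have hlam : lam < max lam₀ (lam + 1) := (lt_add_one lam).trans_le (le_max_right _ _)
  obtain ⟨R, -, hR⟩ := exists_isSolutionOperator hS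
  induction n with
  | zero => exact hp.vacuum_ae_ne_zero hα hu hlam (hlam₀.le.trans (le_max_left _ _)) hR hS
  | succ n ih => exact hp.succ_ae_ne_zero hα hlam hR hS ih

theorem IsSolutionOperator.positivityImproving (hα : 0 < α) (hR : IsSolutionOperator α lam R)
    (hS : IsCoerciveOperator (formOp ℓ α lam)) : PositivityImproving (cone ℓ) R := by
  intro u hu w hw hu0 hw0
  obtain ⟨p, hRu, hp⟩ := hR.exists_isConeSolution hS hu
  rw [hRu]
  refine lt_of_le_of_ne (inner_nonneg_of_mem_cone hp.embed_mem hw) fun h => hw0 ?_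
  refine Hilb_ext fun n => ?_
  change comp w n = 0
  rw [Lp.eq_zero_iff_ae_eq_zero]
  filter_upwards [ae_norm_mul_norm_eq_zero hp.embed_mem hw h.symm n, hp.ae_ne_zero hα hu0 n]
    with z hz hpz
  rw [comp_embed, mul_eq_zero, norm_eq_zero, norm_eq_zero] at hz
  exact hz.resolve_left hpz

end Improving

end Polaron

end

theorem proposition2p4 (α : ℝ) (hα : 0 < α) (ℓ : ℝ) [Fact (0 < ℓ)] :
    ∃ E : ℝ, IsGLB {s : ℝ | (s : ℂ) ∈ Polaron.spec (Polaron.hGraph α ℓ)} E ∧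
      ∀ lam : ℝ, -E < lam →
        ∃ R : Polaron.Hilb ℓ →L[ℂ] Polaron.Hilb ℓ,
          Polaron.IsResolvent (Polaron.hGraph α ℓ) (-(lam : ℂ)) R ∧
            Polaron.PositivityImproving (Polaron.cone ℓ) R := by
  obtain ⟨lam₀, -, hcoercive⟩ := Polaron.exists_isCoerciveOperator_formOp α
  have hS := hcoercive ℓ lam₀ le_rfl
  obtain ⟨R, hpos, hR⟩ := Polaron.exists_isSolutionOperator hS
  refine Polaron.exists_isGLB_spec_forall_positivityImproving
    (fun c hc u hu => Polaron.smul_mem_cone hu hc)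
    ⟨_, Polaron.testVector_mem_cone 0, Polaron.embed_testVector_ne_zero 0⟩
    (hR.isResolvent hS) hpos (fun f hf => hR.mem_cone hS hf) (hR.positivityImproving hα hS)
    fun lam hlam => ?_
  have hS' := hcoercive ℓ lam hlam.le
  obtain ⟨R', -, hR'⟩ := Polaron.exists_isSolutionOperator hS'
  exact ⟨R', hR'.isResolvent hS', hR'.positivityImproving hα hS'⟩
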